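/- **Theorem (convergence of the meshfree scheme to the deterministic nonlocal solution).** Let $d\ge 1$ and $0\le s<d$, and for $\delta>0$ let $$\gamma_\delta(\rho)=\frac{D_0}{\delta^{d+2-s}\rho^{s}}\ \ (0<\rho<\delta),\qquad \gamma_\delta(\rho)=0\ \ (\rho\ge\delta),$$ where the constant $D_0$ is fixed by $\int_{B_1(0)}\gamma_1(|z|)\,|z|^2\,dz=d$; $B_\delta(x)$ is the open Euclidean ball. *Quadrature weights.* For a point set $X$ and a point $x$ put $N(x)=(X\cap B_\delta(x))\setminus\{x\}$. Optimal weights at $x$ are minimizers $(\omega_{y,x})_{y\in N(x)}$ of $\sum_{y\in N(x)}\tfrac12\,\omega_{y,x}^2\,\gamma_\delta(|y-x|)$ subject to $$\sum_{y\in N(x)}p(y-x)\,\gamma_\delta(|y-x|)\,\omega_{y,x}=\int_{B_\delta(x)}p(y-x)\,\gamma_\delta(|y-x|)\,dy$$ for all real polynomials $p$ in $d$ variables of degree at most $3$. A number $C_{pos}>0$ is called admissible if for all $\delta>0$, all $0<h<C_{pos}\delta$ and every $x\in X=h\mathbb Z^d$: a polynomial $p$ of degree at most $3$ with $p(y-x)=0$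 for all $y\in N(x)$ is zero (unisolvency), optimal weights at $x$ exist, and optimal weights are positive at every $y\in N(x)$. *Domain and coefficient.* For a bounded open set $\Omega\subset\mathbb R^d$ let $\Omega_\delta=\{x\notin\Omega:\operatorname{dist}(x,\partial\Omega)<\delta\}$. Let $\delta_{max}>0$, let $D=\Omega\cup\Omega_{\delta_{max}}$, and let $A$ be a symmetric function on $D\times D$ with $0<r\le A(x,y)\le R<\infty$ such that, for each $x\in D$, $A(x,\cdot)\in C^1(D)$, with $|\nabla_yA(x,y)|$ bounded uniformly in $x,y\in D$. *Problems.* For functions $f$ on $\Omega$ and $u^D$ on $\Omega_\delta$, $u^\delta$ is a solution of the nonlocal problem if $$-\mathcal L^\delta[u^\delta](x):=-2\int_{\mathbb R^d}A(x,y)\,\gamma_\delta(|y-x|)\,(u^\delta(y)-u^\delta(x))\,dy=f(x)\ \ (x\in\Omega),\qquad u^\delta=u^D\ \text{ on }\Omega_\delta .$$ With $\chi_h=h\mathbb Z^d\cap(\Omega\cup\Omega_\delta)$ and optimal weights for $X=\chi_h$ at each $x\in\chi_h\cap\Omega$, a numerical solution is a function $u_h^\delta$ on $\chi_h$ with $$-2\sum_{y\in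 N(x)}A(x,y)\,\gamma_\delta(|y-x|)\,(u_h^\delta(y)-u_h^\delta(x))\,\omega_{y,x}=f(x)\ \ (x\in\chi_h\cap\Omega),\qquad u_h^\delta=u^D\ \text{ on }\chi_h\cap\Omega_\delta .$$ *Conclusion.* An admissible $C_{pos}$ exists. For every admissible $C_{pos}$ and all $\Omega,\delta_{max},A$ as above there is $\delta_0>0$ such that for every $0<\delta<\delta_0$ and all $f,u^D$: if $u^\delta$ is a solution of the nonlocal problem that is $C^1$ on $\Omega\cup\Omega_\delta$ with $u^\delta$ and $\nabla u^\delta$ bounded there, then there is a constant $C$, independent of $h$, such that for all $0<h<C_{pos}\delta$ the numerical solution $u_h^\delta$ exists, is unique, and satisfies $$\|u_h^\delta-u^\delta\|_{L^\infty(\chi_h)}=\max_{x\in\chi_h}|u_h^\delta(x)-u^\delta(x)|\le C\,h^{\min(1,\,d-s)} .$$ -/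

import Mathlib

noncomputable section

namespace MeshfreeNonlocal

open MeasureTheory Metric

/-- Physical space `ℝ^d` with its Euclidean norm. -/
abbrev Space (d : ℕ) : Type := EuclideanSpace ℝ (Fin d)

/-! ### The kernel and the nonlocal problem -/

/-- The radial kernel `γ_δ(r) = δ^{-(d+2)} γ₁(r/δ) = D₀ / (δ^{d+2-s} r^s)` for `r < δ`, and `0` for
`r ≥ δ`. (The value at `r = 0` is never used in a sum, and is a null set in every integral.) -/
def kernel (d : ℕ) (s D₀ δ r : ℝ) : ℝ :=
  if r < δ then D₀ / (δ ^ ((d : ℝ) + 2 - s) * r ^ s) else 0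

/-- The normalization `∫_{B_1(0)} γ₁(|z|) |z|² dz = d`, which determines the constant `D₀`. -/
def KernelNormalized (d : ℕ) (s D₀ : ℝ) : Prop :=
  ∫ z in ball (0 : Space d) 1, kernel d s D₀ 1 ‖z‖ * ‖z‖ ^ 2 = (d : ℝ)

/-- The nonlocal boundary `Ω_δ = {x ∉ Ω : dist(x, ∂Ω) < δ}`. -/
def collar {d : ℕ} (Ω : Set (Space d)) (δ : ℝ) : Set (Space d) :=
  thickening δ (frontier Ω) \ Ω

/-- The interaction region `Ω ∪ Ω_δ`. -/
def region {d : ℕ} (Ω : Set (Space d)) (δ : ℝ) : Set (Space d) :=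
  Ω ∪ collar Ω δ

/-- `g` is of class `C¹` on the (open) set `D` with `C¹`-norm controlled by `M`:
`|g| ≤ M` and `|∇g| ≤ M` on `D`. -/
def C1BoundedBy {d : ℕ} (M : ℝ) (g : Space d → ℝ) (D : Set (Space d)) : Prop :=
  ContDiffOn ℝ 1 g D ∧ ∀ y ∈ D, |g y| ≤ M ∧ ‖fderiv ℝ g y‖ ≤ M

/-- `𝓛^δ[u](x) = 2 ∫ A(x,y) γ_δ(|y-x|) (u(y) - u(x)) dy`. -/
def nonlocalOp {d : ℕ} (s D₀ δ : ℝ) (A : Space d → Space d → ℝ) (u : Space d → ℝ)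
    (x : Space d) : ℝ :=
  2 * ∫ y, A x y * kernel d s D₀ δ ‖y - x‖ * (u y - u x)

/-- `u` solves `-𝓛^δ[u] = f` in `Ω`, `u = u^D` in `Ω_δ`. -/
def IsNonlocalSolution {d : ℕ} (s D₀ δ : ℝ) (Ω : Set (Space d)) (A : Space d → Space d → ℝ)
    (f uD u : Space d → ℝ) : Prop :=
  (∀ x ∈ Ω, -nonlocalOp s D₀ δ A u x = f x) ∧ ∀ x ∈ collar Ω δ, u x = uD x

/-! ### The grid -/

/-- The lattice `h ℤ^d`. -/
def lattice (d : ℕ) (h : ℝ) : Set (Space d) :=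
  {x | ∃ k : Fin d → ℤ, ∀ i, x i = (k i : ℝ) * h}

/-- The uniform Cartesian grid `χ_h = h ℤ^d ∩ (Ω ∪ Ω_δ)`. -/
def grid {d : ℕ} (Ω : Set (Space d)) (δ h : ℝ) : Set (Space d) :=
  lattice d h ∩ region Ω δ

/-- The interacting neighbours of `x` in the point set `X`: `(X ∩ B_δ(x)) \ {x}`. -/
def nbrs {d : ℕ} (X : Set (Space d)) (δ : ℝ) (x : Space d) : Set (Space d) :=
  (X ∩ ball x δ) \ {x}

/-- The index sets of all the sums below are finite. -/
theorem nbrs_finite {d : ℕ} {h : ℝ} (hh : 0 < h) {X : Set (Space d)} (hX : X ⊆ lattice d h)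
    (δ : ℝ) (x : Space d) : (nbrs X δ x).Finite := by
  classical
  have key : (lattice d h ∩ ball x δ).Finite := by
    have hfin : (Set.pi Set.univ fun i : Fin d =>
        Set.Icc ⌊(x i - δ) / h⌋ ⌈(x i + δ) / h⌉).Finite :=
      Set.Finite.pi fun i => Set.finite_Icc _ _
    refine (hfin.image fun k : Fin d → ℤ =>
      (WithLp.toLp 2 fun i => (k i : ℝ) * h : Space d)).subset ?_
    rintro y ⟨⟨k, hk⟩, hy⟩
    refine ⟨k, ?_, ?_⟩
    · intro i _
      have h1 : |y i - x i| < δ := by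
        have h2 : ‖(y - x) i‖ ≤ ‖y - x‖ := PiLp.norm_apply_le (y - x) i
        rw [mem_ball, dist_eq_norm] at hy
        have h3 : ‖(y - x) i‖ = |y i - x i| := by simp [Real.norm_eq_abs]
        linarith
      rw [abs_lt, hk i] at h1
      have h4 : (x i - δ) / h ≤ (k i : ℝ) := by
        rw [div_le_iff₀ hh]; linarith [h1.1]
      have h5 : (k i : ℝ) ≤ (x i + δ) / h := by
        rw [le_div_iff₀ hh]; linarith [h1.2]
      constructor
      · exact Int.cast_le.1 ((Int.floor_le _).trans h4)
      · exact Int.cast_le.1 (h5.trans (Int.le_ceil _))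
    · ext i
      exact (hk i).symm
  exact key.subset fun y hy => ⟨hX hy.1.1, hy.1.2⟩

/-! ### Optimization-based quadrature weights -/

/-- Evaluation of a polynomial in `d` variables at a point of `ℝ^d`. -/
def polyEval {d : ℕ} (p : MvPolynomial (Fin d) ℝ) (z : Space d) : ℝ :=
  MvPolynomial.eval (fun i => z i) p

/-- The constraint `I_h[q] = I[q]` for all `q(x, y) = p(y - x) γ_δ(|y - x|)` with `p` a polynomial
of degree at most three. Here `w y` is the weight of the quadrature point `y`. -/
def Reproduces {d : ℕ} (s D₀ δ : ℝ) (X : Set (Space d)) (x : Space d) (w : Space d → ℝ) : Prop :=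
  ∀ p : MvPolynomial (Fin d) ℝ, p.totalDegree ≤ 3 →
    ∑ᶠ y ∈ nbrs X δ x, polyEval p (y - x) * kernel d s D₀ δ ‖y - x‖ * w y =
      ∫ y in ball x δ, polyEval p (y - x) * kernel d s D₀ δ ‖y - x‖

/-- The objective `∑ ω_j² W(|x_j - x|) / 2`, with `W = γ_δ`. -/
def weightCost {d : ℕ} (s D₀ δ : ℝ) (X : Set (Space d)) (x : Space d) (w : Space d → ℝ) : ℝ :=
  ∑ᶠ y ∈ nbrs X δ x, (w y) ^ 2 * kernel d s D₀ δ ‖y - x‖ / 2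

/-- `w` is a solution of the quadrature optimization problem at the point `x`. -/
def IsOptimalWeights {d : ℕ} (s D₀ δ : ℝ) (X : Set (Space d)) (x : Space d)
    (w : Space d → ℝ) : Prop :=
  Reproduces s D₀ δ X x w ∧
    ∀ w' : Space d → ℝ, Reproduces s D₀ δ X x w' →
      weightCost s D₀ δ X x w ≤ weightCost s D₀ δ X x w'

/-- The neighbours of `x` are unisolvent for the polynomials of degree at most three. -/
def Unisolvent {d : ℕ} (δ : ℝ) (X : Set (Space d)) (x : Space d) : Prop :=
  ∀ p : MvPolynomial (Fin d) ℝ, p.totalDegree ≤ 3 →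
    (∀ y ∈ nbrs X δ x, polyEval p (y - x) = 0) → p = 0

/-- `c` is an admissible value of `C_pos`: for every horizon `δ` and every `0 < h < c δ`, at each
point of `h ℤ^d` unisolvency holds, the quadrature optimization problem is solvable, and the
optimal weights are all positive. -/
def IsPosConst (d : ℕ) (s D₀ c : ℝ) : Prop :=
  0 < c ∧ ∀ δ h : ℝ, 0 < δ → 0 < h → h < c * δ → ∀ x ∈ lattice d h,
    Unisolvent δ (lattice d h) x ∧
    (∃ w, IsOptimalWeights s D₀ δ (lattice d h) x w) ∧
    ∀ w, IsOptimalWeights s D₀ δ (lattice d h) x w → ∀ y ∈ nbrs (lattice d h) δ x, 0 < w y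

/-! ### The meshfree discretization -/

/-- `𝓛_h^δ v (x) = 2 ∑_{x_j ∈ χ_h ∩ B_δ(x) \ {x}} A(x,x_j) γ_δ(|x-x_j|) (v(x_j) - v(x)) ω_j(x)`;
`ω x y` is the weight of the quadrature point `y` in the rule centred at `x`. -/
def discreteOp {d : ℕ} (s D₀ δ h : ℝ) (Ω : Set (Space d)) (A ω : Space d → Space d → ℝ)
    (v : Space d → ℝ) (x : Space d) : ℝ :=
  2 * ∑ᶠ y ∈ nbrs (grid Ω δ h) δ x,
    A x y * kernel d s D₀ δ ‖y - x‖ * (v y - v x) * ω x y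

/-- `v` (only its values on `χ_h` matter) solves the discretized nonlocal problem. -/
def IsDiscreteSolution {d : ℕ} (s D₀ δ h : ℝ) (Ω : Set (Space d)) (A ω : Space d → Space d → ℝ)
    (f uD v : Space d → ℝ) : Prop :=
  (∀ x ∈ grid Ω δ h ∩ Ω, -discreteOp s D₀ δ h Ω A ω v x = f x) ∧
    ∀ x ∈ grid Ω δ h ∩ collar Ω δ, v x = uD x

end MeshfreeNonlocal

end

open MeshfreeNonlocal

noncomputable section

namespace MeshfreeNonlocal

open MeasureTheory Metric Filter Asymptotics
open scoped Topology Pointwise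

variable {d : ℕ}

/-! ### Rounding to the lattice -/

/-! The theorem is consistency plus stability. If `u_h = u + v`, then `v` vanishes off `Ω` and its
discrete operator equals the difference between the nonlocal and the discrete operator at `u`.
`consistency` bounds that difference by `O(h^α)` with `α = min(1, d - s)`, and `stability` bounds
`v` by its residual, which also yields existence and uniqueness because the discrete system is
square.

The weights. The cost and the constraints carry the same factor `γ_δ`, so any feasible weight of the
form `q(y - x)` with `deg q ≤ 3` is optimal, and is the only optimal one on the neighbours
(`optimal_of_polynomial`). After translation and dilation to `x = 0`, `δ = 1`, finding `q` means
solving a linear system with the Gram matrix of lattice moments. That matrix converges at rate `h^α`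
to the Gram matrix of `∫_{B_1} p q |z|^{-s}`, which is definite. Hence `q` is `h^d (1 +
O((h/δ)^α))`, and the weights are positive on fine meshes: this gives `C_pos`.

The rate. For a Lipschitz `g` with `g(0) = 0`, the lattice sum of `g(y)|y|^{-s}` has error `O(h)`.
For `|y|^{-s}` alone, the omitted cell at the origin costs `h^{d-s}`, the cells cut by the sphere
cost `h`, and the other cells cost `h² ∫_{|z|>h/2} |z|^{-s-2}`, again `O(h^α)`. The moments of `1`
govern the weights, so `α` is the final rate.

Stability. Positive weights give a discrete maximum principle. The barrier is `exp(λ x_i)`: exact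
reproduction of the first and second moments makes its discrete operator bounded below uniformly in
`h` and `δ`, once `λ` dominates the gradient of `A` and `λδ ≤ 1`. The last condition determines
`δ₀`. -/

/-- The lattice point of `h ℤ^d` whose (half-open) cell contains `z`. -/
def snap (h : ℝ) (z : Space d) : Space d :=
  WithLp.toLp 2 fun i => (⌊z i / h + 1 / 2⌋ : ℝ) * h

/-- The half-open cell of side `h` centred at `y`. -/
def cell (h : ℝ) (y : Space d) : Set (Space d) :=
  {z | ∀ i, z i ∈ Set.Ico (y i - h / 2) (y i + h / 2)}

theorem snap_apply (h : ℝ) (z : Space d) (i : Fin d) :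
    snap h z i = (⌊z i / h + 1 / 2⌋ : ℝ) * h := rfl

theorem snap_mem_lattice (h : ℝ) (z : Space d) : snap h z ∈ lattice d h :=
  ⟨fun i => ⌊z i / h + 1 / 2⌋, fun _ => rfl⟩

theorem snap_eq_iff {h : ℝ} (hh : 0 < h) {y : Space d} (hy : y ∈ lattice d h) (z : Space d) :
    snap h z = y ↔ z ∈ cell h y := by
  obtain ⟨k, hk⟩ := hy
  have key : ∀ i, snap h z i = y i ↔ z i ∈ Set.Ico (y i - h / 2) (y i + h / 2) := by
    intro i
    rw [snap_apply, hk i, mul_left_inj' hh.ne', Int.cast_inj, Int.floor_eq_iff, Set.mem_Ico]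
    have e : z i = z i / h * h := by field_simp
    constructor
    · rintro ⟨h1, h2⟩
      constructor
      · rw [e]; nlinarith
      · rw [e]; nlinarith
    · rintro ⟨h1, h2⟩
      constructor
      · rw [← sub_le_iff_le_add, le_div_iff₀ hh]; linarith
      · rw [← lt_sub_iff_add_lt, div_lt_iff₀ hh]; linarith
  constructor
  · intro e i
    exact (key i).1 (by rw [e])
  · intro e
    ext i
    exact (key i).2 (e i)

theorem mem_cell_snap {h : ℝ} (hh : 0 < h) (z : Space d) : z ∈ cell h (snap h z) :=
  (snap_eq_iff hh (snap_mem_lattice h z) z).1 rfl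

theorem norm_le_of_abs_le {c : ℝ} {v : Space d} (hv : ∀ i, |v i| ≤ c) : ‖v‖ ≤ d * c := by
  calc ‖v‖ = ‖∑ i, EuclideanSpace.single i (v i)‖ := by
        congr 1
        ext i
        simp [Pi.single_apply]
    _ ≤ ∑ i, ‖EuclideanSpace.single i (v i)‖ := norm_sum_le _ _
    _ ≤ ∑ _i : Fin d, c := Finset.sum_le_sum fun i _ => by simpa using hv i
    _ = d * c := by simp

theorem abs_apply_le_norm (v : Space d) (i : Fin d) : |v i| ≤ ‖v‖ := by
  simpa [Real.norm_eq_abs] using PiLp.norm_apply_le v i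

theorem norm_sub_snap_le {h : ℝ} (hh : 0 < h) (z : Space d) :
    ‖z - snap h z‖ ≤ d * (h / 2) := by
  refine norm_le_of_abs_le fun i => ?_
  have := mem_cell_snap hh z i
  rw [PiLp.sub_apply, abs_le]
  constructor <;> linarith [this.1, this.2]

theorem le_norm_of_mem_lattice {h : ℝ} (hh : 0 < h) {y : Space d} (hy : y ∈ lattice d h)
    (hy0 : y ≠ 0) : ∃ i, h ≤ |y i| := by
  obtain ⟨k, hk⟩ := hy
  by_contra! hc
  apply hy0
  ext i
  have := hc i
  rw [hk i, abs_mul, abs_of_pos hh] at this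
  have h1 : |(k i : ℝ)| < 1 := by
    by_contra! h2
    nlinarith
  have h2 : k i = 0 := by
    rw [← Int.abs_lt_one_iff]
    exact_mod_cast h1
  simp [hk i, h2]

theorem half_le_norm_of_snap_ne {h : ℝ} (hh : 0 < h) {z : Space d} (hz : snap h z ≠ 0) :
    h / 2 ≤ ‖z‖ := by
  obtain ⟨i, hi⟩ := le_norm_of_mem_lattice hh (snap_mem_lattice h z) hz
  refine le_trans ?_ (abs_apply_le_norm z i)
  have := mem_cell_snap hh z i
  rcases le_abs'.1 hi with h1 | h1
  · rw [le_abs']; left; linarith [this.2]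
  · rw [le_abs]; left; linarith [this.1]

/-- Rounding moves a point by at most `d h / 2`, and a nonzero lattice point has norm at least `h`.
Together with `snap_norm_le`, this makes `|z|` and its rounding comparable, uniformly in `h`,
outside the cell of the origin. -/
theorem norm_le_snap {h : ℝ} (hh : 0 < h) {z : Space d} (hz : snap h z ≠ 0) :
    ‖z‖ ≤ (d + 1) * ‖snap h z‖ := by
  obtain ⟨i, hi⟩ := le_norm_of_mem_lattice hh (snap_mem_lattice h z) hz
  have h1 := hi.trans (abs_apply_le_norm _ i)
  have h2 := norm_sub_snap_le hh z
  have h3 : ‖z‖ ≤ ‖z - snap h z‖ + ‖snap h z‖ := by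
    simpa using norm_add_le (z - snap h z) (snap h z)
  have h4 : (d : ℝ) * (h / 2) ≤ d * ‖snap h z‖ := by gcongr; linarith
  linarith

theorem snap_norm_le {h : ℝ} (hh : 0 < h) {z : Space d} (hz : snap h z ≠ 0) :
    ‖snap h z‖ ≤ (d + 1) * ‖z‖ := by
  have h1 := half_le_norm_of_snap_ne hh hz
  have h2 := norm_sub_snap_le hh z
  have h3 : ‖snap h z‖ ≤ ‖z‖ + ‖z - snap h z‖ := by
    have := norm_sub_le z (z - snap h z)
    simpa using this
  have h4 : (d : ℝ) * (h / 2) ≤ d * ‖z‖ := by gcongr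
  linarith

theorem cell_eq_preimage (h : ℝ) (y : Space d) :
    cell h y = (WithLp.ofLp : Space d → (Fin d → ℝ)) ⁻¹'
      (Set.univ.pi fun i => Set.Ico (y i - h / 2) (y i + h / 2)) := by
  ext z
  simp [cell, Set.mem_pi]

theorem measurableSet_cell (h : ℝ) (y : Space d) : MeasurableSet (cell h y) := by
  rw [cell_eq_preimage]
  exact (PiLp.volume_preserving_ofLp (Fin d)).measurable
    (MeasurableSet.univ_pi fun i => measurableSet_Ico)

theorem volume_cell {h : ℝ} (hh : 0 < h) (y : Space d) :
    volume (cell h y) = ENNReal.ofReal (h ^ d) := by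
  rw [cell_eq_preimage, (PiLp.volume_preserving_ofLp (Fin d)).measure_preimage
    (MeasurableSet.univ_pi fun i => measurableSet_Ico).nullMeasurableSet, Real.volume_pi_Ico]
  have : ∀ i : Fin d, y i + h / 2 - (y i - h / 2) = h := fun i => by ring
  simp [this, ENNReal.ofReal_pow hh.le]

/-- Half-open cells partition space, but only the closed cube is invariant under reflection in its
centre; this passes from one to the other. -/
theorem cell_ae_eq (h : ℝ) (y : Space d) :
    cell h y =ᵐ[volume] {z : Space d | ∀ i, |z i - y i| ≤ h / 2} := by
  have h1 : {z : Space d | ∀ i, |z i - y i| ≤ h / 2} =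
      (WithLp.ofLp : Space d → (Fin d → ℝ)) ⁻¹'
        (Set.Icc (fun i => y i - h / 2) (fun i => y i + h / 2)) := by
    ext z
    simp only [Set.mem_ofPred_eq, Set.mem_preimage, Set.mem_Icc, Pi.le_def, ← forall_and]
    refine forall_congr' fun i => ?_
    rw [abs_le]
    constructor <;> rintro ⟨h1, h2⟩ <;> constructor <;> linarith
  rw [cell_eq_preimage, h1]
  exact (PiLp.volume_preserving_ofLp (Fin d)).quasiMeasurePreserving.preimage_ae_eq
    Measure.univ_pi_Ico_ae_eq_Icc

theorem integrableOn_coord_cell {h : ℝ} (hh : 0 < h) (y : Space d) (i : Fin d) :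
    IntegrableOn (fun z : Space d => z i - y i) (cell h y) := by
  refine Measure.integrableOn_of_bounded (M := h / 2) ?_ ?_ ?_
  · rw [volume_cell hh]; exact ENNReal.ofReal_ne_top
  · fun_prop
  · refine (ae_restrict_iff' (measurableSet_cell h y)).2 (Filter.Eventually.of_forall ?_)
    intro z hz
    have := hz i
    rw [Real.norm_eq_abs, abs_le]
    constructor <;> linarith [this.1, this.2]

theorem setIntegral_coord_cell (h : ℝ) (y : Space d) (i : Fin d) :
    ∫ z in cell h y, (z i - y i) = 0 := by
  rw [setIntegral_congr_set (cell_ae_eq h y)]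
  set Q := {z : Space d | ∀ i, |z i - y i| ≤ h / 2}
  have hQ : MeasurableSet Q := by
    have : Q = ⋂ i, {z : Space d | |z i - y i| ≤ h / 2} := by ext; simp [Q]
    rw [this]
    refine MeasurableSet.iInter fun i => measurableSet_le ?_ measurable_const
    fun_prop
  rw [← integral_indicator hQ]
  -- The reflection `z ↦ 2y - z` preserves the cube and changes the sign of the integrand.
  have h1 := integral_sub_left_eq_self (μ := (volume : Measure (Space d)))
    (Q.indicator fun z => z i - y i) ((2 : ℝ) • y)
  have h2 : (fun z : Space d => Q.indicator (fun z => z i - y i) ((2 : ℝ) • y - z)) =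
      fun z => -Q.indicator (fun z => z i - y i) z := by
    ext z
    have e : (2 : ℝ) • y - z ∈ Q ↔ z ∈ Q := by
      refine forall_congr' fun j => ?_
      have : ((2 : ℝ) • y - z) j - y j = -(z j - y j) := by
        simp only [PiLp.sub_apply, PiLp.smul_apply, smul_eq_mul]; ring
      rw [this, abs_neg]
    by_cases hz : z ∈ Q
    · rw [Set.indicator_of_mem hz, Set.indicator_of_mem (e.2 hz)]
      simp only [PiLp.sub_apply, PiLp.smul_apply, smul_eq_mul]; ring
    · rw [Set.indicator_of_notMem hz, Set.indicator_of_notMem (fun h => hz (e.1 h)), neg_zero]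
  rw [h2, integral_neg] at h1
  linarith

/-! ### Lattice sums as integrals of functions constant, or linear, on cells -/

section sums

variable {h : ℝ} (hh : 0 < h) {S : Finset (Space d)} (hS : ∀ y ∈ S, y ∈ lattice d h)
include hh hS

open Classical in
theorem ite_snap_eq_sum (Φ : Space d → Space d → ℝ) (z : Space d) :
    (if snap h z ∈ S then Φ (snap h z) z else 0) =
      ∑ y ∈ S, (cell h y).indicator (Φ y) z := by
  have h1 : ∀ y ∈ S, (cell h y).indicator (Φ y) z =
      if snap h z = y then Φ (snap h z) z else 0 := by
    intro y hy
    by_cases hz : snap h z = y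
    · rw [if_pos hz, Set.indicator_of_mem ((snap_eq_iff hh (hS y hy) z).1 hz), hz]
    · rw [if_neg hz, Set.indicator_of_notMem fun h => hz ((snap_eq_iff hh (hS y hy) z).2 h)]
  rw [Finset.sum_congr rfl h1, Finset.sum_ite_eq]

open Classical in
theorem integrable_ite_snap {Φ : Space d → Space d → ℝ}
    (hΦ : ∀ y ∈ S, IntegrableOn (Φ y) (cell h y)) :
    Integrable fun z => if snap h z ∈ S then Φ (snap h z) z else 0 := by
  simp_rw [ite_snap_eq_sum hh hS]
  exact integrable_finsetSum _ fun y hy =>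
    (integrable_indicator_iff (measurableSet_cell h y)).2 (hΦ y hy)

open Classical in
theorem integral_ite_snap {Φ : Space d → Space d → ℝ}
    (hΦ : ∀ y ∈ S, IntegrableOn (Φ y) (cell h y)) :
    ∫ z, (if snap h z ∈ S then Φ (snap h z) z else 0) = ∑ y ∈ S, ∫ z in cell h y, Φ y z := by
  simp_rw [ite_snap_eq_sum hh hS]
  rw [integral_finsetSum _ fun y hy =>
    (integrable_indicator_iff (measurableSet_cell h y)).2 (hΦ y hy)]
  exact Finset.sum_congr rfl fun y _ => integral_indicator (measurableSet_cell h y)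

open Classical in
theorem integrable_comp_snap (F : Space d → ℝ) :
    Integrable fun z => if snap h z ∈ S then F (snap h z) else 0 :=
  integrable_ite_snap (Φ := fun y _ => F y) hh hS fun y _ =>
    integrableOn_const (by rw [volume_cell hh]; exact ENNReal.ofReal_ne_top)

open Classical in
theorem integral_comp_snap (F : Space d → ℝ) :
    ∫ z, (if snap h z ∈ S then F (snap h z) else 0) = h ^ d * ∑ y ∈ S, F y := by
  rw [integral_ite_snap (Φ := fun y _ => F y) hh hS fun y _ =>
    integrableOn_const (by rw [volume_cell hh]; exact ENNReal.ofReal_ne_top), Finset.mul_sum]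
  refine Finset.sum_congr rfl fun y _ => ?_
  rw [setIntegral_const, measureReal_def, volume_cell hh, ENNReal.toReal_ofReal (by positivity),
    smul_eq_mul]

open Classical in
theorem integrable_linear_snap (a : Space d → ℝ) :
    Integrable fun z => if snap h z ∈ S then
      a (snap h z) * inner ℝ (snap h z) (z - snap h z) else 0 := by
  refine integrable_ite_snap (Φ := fun y z => a y * inner ℝ y (z - y)) hh hS fun y _ => ?_
  have : (fun z : Space d => a y * inner ℝ y (z - y)) =
      fun z => a y * ∑ i, y i * (z i - y i) := by
    ext z; simp [PiLp.inner_apply, mul_comm]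
  rw [this]
  exact (integrable_finsetSum _ fun i _ =>
    (integrableOn_coord_cell hh y i).integrable.const_mul _).const_mul _

-- Cells are centred at their lattice points, so a linear term integrates to zero on each. A
-- first-order Taylor correction can thus be added to a Riemann sum for free, which gains one order
-- in the pointwise comparison.
open Classical in
theorem integral_linear_snap (a : Space d → ℝ) :
    ∫ z, (if snap h z ∈ S then
      a (snap h z) * inner ℝ (snap h z) (z - snap h z) else 0) = 0 := by
  have e : ∀ y : Space d, (fun z : Space d => a y * inner ℝ y (z - y)) =
      fun z => a y * ∑ i, y i * (z i - y i) := by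
    intro y; ext z; simp [PiLp.inner_apply, mul_comm]
  rw [integral_ite_snap (Φ := fun y z => a y * inner ℝ y (z - y)) hh hS]
  · refine Finset.sum_eq_zero fun y _ => ?_
    rw [e, integral_const_mul, integral_finsetSum _ fun i _ =>
      (integrableOn_coord_cell hh y i).integrable.const_mul _]
    simp [integral_const_mul, setIntegral_coord_cell]
  · intro y _
    rw [e]
    exact (integrable_finsetSum _ fun i _ =>
      (integrableOn_coord_cell hh y i).integrable.const_mul _).const_mul _

end sums

/-! ### Integrals of powers of the norm -/

theorem nontrivial_space (hd : 0 < d) : Nontrivial (Space d) := by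
  have : Nonempty (Fin d) := ⟨⟨0, hd⟩⟩
  infer_instance

theorem integrableOn_norm_rpow_ball (hd : 0 < d) {s : ℝ} (hsd : s < d) (r : ℝ) :
    IntegrableOn (fun z : Space d => ‖z‖ ^ (-s)) (ball 0 r) := by
  have := nontrivial_space hd
  rcases le_or_gt r 0 with hr | hr
  · rw [ball_eq_empty.2 hr]; exact integrableOn_empty
  rw [integrableOn_fun_norm_addHaar volume (f := fun t : ℝ => t ^ (-s)), finrank_euclideanSpace_fin]
  have h1 : IntegrableOn (fun t : ℝ => t ^ ((d : ℝ) - 1 - s)) (Set.Ioo 0 r) :=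
    (intervalIntegral.integrableOn_Ioo_rpow_iff hr).2 (by linarith)
  refine h1.congr_fun (fun t ht => ?_) measurableSet_Ioo
  have e : ((d - 1 : ℕ) : ℝ) = (d : ℝ) - 1 := by
    rw [Nat.cast_sub hd]; simp
  rw [smul_eq_mul, ← Real.rpow_natCast, ← Real.rpow_add ht.1, e]
  ring_nf

theorem norm_smul_rpow {R : ℝ} (hR : 0 < R) (s : ℝ) (z : Space d) :
    ‖R • z‖ ^ (-s) = R ^ (-s) * ‖z‖ ^ (-s) := by
  rw [norm_smul, Real.norm_of_nonneg hR.le, Real.mul_rpow hR.le (norm_nonneg z)]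

theorem setIntegral_norm_rpow_smul {R : ℝ} (hR : 0 < R) (s : ℝ) (A : Set (Space d)) :
    ∫ z in R • A, ‖z‖ ^ (-s) = R ^ ((d : ℝ) - s) * ∫ z in A, ‖z‖ ^ (-s) := by
  have h1 := Measure.setIntegral_comp_smul_of_pos (volume : Measure (Space d))
    (fun z : Space d => ‖z‖ ^ (-s)) A hR
  simp_rw [norm_smul_rpow hR] at h1
  rw [integral_const_mul, finrank_euclideanSpace_fin, smul_eq_mul] at h1
  rw [Real.rpow_sub hR, Real.rpow_natCast, div_eq_mul_inv, ← Real.rpow_neg hR.le, mul_assoc, h1,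
    ← mul_assoc, mul_inv_cancel₀ (by positivity), one_mul]

theorem setIntegral_norm_rpow_ball {r : ℝ} (hr : 0 < r) (s : ℝ) :
    ∫ z in ball (0 : Space d) r, ‖z‖ ^ (-s) =
      r ^ ((d : ℝ) - s) * ∫ z in ball (0 : Space d) 1, ‖z‖ ^ (-s) := by
  rw [← setIntegral_norm_rpow_smul hr]
  congr 2
  rw [_root_.smul_ball hr.ne', smul_zero, Real.norm_of_nonneg hr.le, mul_one]

theorem integrableOn_norm_rpow_compl_ball {σ : ℝ} (hσ : (d : ℝ) < σ) {r : ℝ} (hr : 0 < r) :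
    IntegrableOn (fun z : Space d => ‖z‖ ^ (-σ)) (ball 0 r)ᶜ := by
  have h1 : Integrable (fun z : Space d => (1 + ‖z‖) ^ (-σ)) :=
    integrable_one_add_norm (by simpa using hσ)
  have hσ0 : 0 ≤ σ := le_trans (Nat.cast_nonneg d) hσ.le
  refine Integrable.mono' ((h1.const_mul ((r / (1 + r)) ^ (-σ))).integrableOn)
    (measurable_norm.pow_const _).aestronglyMeasurable ?_
  refine (ae_restrict_iff' measurableSet_ball.compl).2 (Filter.Eventually.of_forall fun z hz => ?_)
  have hz' : r ≤ ‖z‖ := by simpa using hz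
  have hz0 : 0 < ‖z‖ := hr.trans_le hz'
  rw [Real.norm_of_nonneg (by positivity), ← Real.mul_rpow (by positivity) (by positivity)]
  refine Real.rpow_le_rpow_of_nonpos (by positivity) ?_ (by linarith)
  rw [div_mul_eq_mul_div, div_le_iff₀ (by positivity)]
  nlinarith

/-- The part of the unit ball outside a ball of radius `h / 2`. -/
def hollowBall (d : ℕ) (h : ℝ) : Set (Space d) := ball 0 1 \ ball 0 (h / 2)

theorem measurableSet_hollowBall (h : ℝ) : MeasurableSet (hollowBall d h) :=
  measurableSet_ball.diff measurableSet_ball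

theorem integrableOn_norm_rpow_hollowBall (σ : ℝ) {h : ℝ} (hh : 0 < h) :
    IntegrableOn (fun z : Space d => ‖z‖ ^ (-σ)) (hollowBall d h) := by
  have hc : IsCompact (closedBall (0 : Space d) 1 \ ball 0 (h / 2)) :=
    (isCompact_closedBall _ _).diff isOpen_ball
  refine IntegrableOn.mono_set (ContinuousOn.integrableOn_compact hc ?_)
    (Set.sdiff_subset_sdiff_left ball_subset_closedBall)
  refine ContinuousOn.rpow_const (by fun_prop) fun z hz => Or.inl ?_
  have : h / 2 ≤ ‖z‖ := by simpa using hz.2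
  linarith

/-- If `d - s > 1`, one factor `|z|⁻¹ ≤ 2/h` is given away and the remaining power `|z|^{-(s+1)}` is
integrable at the origin. If `d - s ≤ 1`, then `s + 2 > d`, so the integral can be extended to
infinity and scales exactly like `h^{d-s-2}`. No logarithm appears at `d - s = 1`. -/
theorem sq_mul_setIntegral_hollowBall_le (hd : 0 < d) {s : ℝ} :
    ∃ C : ℝ, 0 ≤ C ∧ ∀ h : ℝ, 0 < h → h < 1 →
      h ^ 2 * ∫ z in hollowBall d h, ‖z‖ ^ (-(s + 2)) ≤ C * h ^ min 1 ((d : ℝ) - s) := by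
  rcases lt_or_ge 1 ((d : ℝ) - s) with hds | hds
  · have hint : IntegrableOn (fun z : Space d => ‖z‖ ^ (-(s + 1))) (ball 0 1) :=
      integrableOn_norm_rpow_ball hd (by linarith) 1
    refine ⟨2 * ∫ z in ball (0 : Space d) 1, ‖z‖ ^ (-(s + 1)), ?_, fun h hh hh1 => ?_⟩
    · exact mul_nonneg (by norm_num) (integral_nonneg fun z => by positivity)
    rw [min_eq_left hds.le, Real.rpow_one]
    have h1 : ∫ z in hollowBall d h, ‖z‖ ^ (-(s + 2)) ≤
        ∫ z in hollowBall d h, (2 / h) * ‖z‖ ^ (-(s + 1)) := by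
      refine setIntegral_mono_on (integrableOn_norm_rpow_hollowBall _ hh)
        ((integrableOn_norm_rpow_hollowBall _ hh).const_mul _) (measurableSet_hollowBall h)
        fun z hz => ?_
      have hz2 : h / 2 ≤ ‖z‖ := by simpa using hz.2
      have hz0 : 0 < ‖z‖ := by linarith
      have e : ‖z‖ ^ (-(s + 2)) = ‖z‖⁻¹ * ‖z‖ ^ (-(s + 1)) := by
        rw [← Real.rpow_neg_one, ← Real.rpow_add hz0]; ring_nf
      rw [e]
      gcongr
      rw [inv_le_comm₀ hz0 (by positivity), inv_div]
      exact hz2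
    rw [integral_const_mul] at h1
    have h2 : ∫ z in hollowBall d h, ‖z‖ ^ (-(s + 1)) ≤
        ∫ z in ball (0 : Space d) 1, ‖z‖ ^ (-(s + 1)) :=
      setIntegral_mono_set hint (Filter.Eventually.of_forall fun z => by positivity)
        (Set.sdiff_subset.eventuallyLE)
    calc h ^ 2 * ∫ z in hollowBall d h, ‖z‖ ^ (-(s + 2))
        ≤ h ^ 2 * (2 / h * ∫ z in ball (0 : Space d) 1, ‖z‖ ^ (-(s + 1))) := by
          gcongr
          linarith [mul_le_mul_of_nonneg_left h2 (show 0 ≤ 2 / h by positivity)]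
      _ = _ := by field_simp
  · set B : Set (Space d) := (ball 0 (1 / 2))ᶜ
    refine ⟨∫ z in B, ‖z‖ ^ (-(s + 2)), integral_nonneg fun z => by positivity,
      fun h hh hh1 => ?_⟩
    rw [min_eq_right hds]
    have hB : hollowBall d h ⊆ h • B := by
      intro z hz
      rw [Set.mem_smul_set_iff_inv_smul_mem₀ hh.ne']
      have hz2 : h / 2 ≤ ‖z‖ := by simpa using hz.2
      simp only [B, Set.mem_compl_iff, mem_ball_zero_iff, not_lt, norm_smul, norm_inv,
        Real.norm_of_nonneg hh.le]
      rw [← div_eq_inv_mul, le_div_iff₀ hh]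
      linarith
    have hB2 : h • B = (ball 0 (h / 2))ᶜ := by
      ext z
      rw [Set.mem_smul_set_iff_inv_smul_mem₀ hh.ne']
      simp only [B, Set.mem_compl_iff, mem_ball_zero_iff, not_lt, norm_smul, norm_inv,
        Real.norm_of_nonneg hh.le]
      rw [← div_eq_inv_mul, le_div_iff₀ hh, one_div_mul_eq_div]
    have h1 : ∫ z in hollowBall d h, ‖z‖ ^ (-(s + 2)) ≤ ∫ z in h • B, ‖z‖ ^ (-(s + 2)) := by
      refine setIntegral_mono_set ?_ (Filter.Eventually.of_forall fun z => by positivity)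
        hB.eventuallyLE
      rw [hB2]
      exact integrableOn_norm_rpow_compl_ball (by linarith) (by positivity)
    rw [setIntegral_norm_rpow_smul hh] at h1
    calc h ^ 2 * ∫ z in hollowBall d h, ‖z‖ ^ (-(s + 2))
        ≤ h ^ 2 * (h ^ ((d : ℝ) - (s + 2)) * ∫ z in B, ‖z‖ ^ (-(s + 2))) := by gcongr
      _ = _ := by
        rw [← mul_assoc, ← Real.rpow_natCast, ← Real.rpow_add hh, mul_comm]
        congr 2
        push_cast; ring

/-! ### The boundary layer around the sphere -/

/-- The annulus of half-width `η` around the sphere of radius `δ`. -/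
def annulus (d : ℕ) (δ η : ℝ) : Set (Space d) := ball 0 (δ + η) \ ball 0 (δ - η)

theorem measurableSet_annulus (δ η : ℝ) : MeasurableSet (annulus d δ η) :=
  measurableSet_ball.diff measurableSet_ball

theorem volume_annulus_le (hd : 0 < d) {δ : ℝ} (hδ : 0 < δ) :
    ∃ C : ℝ, 0 ≤ C ∧ ∀ η : ℝ, 0 < η → η < δ → volume.real (annulus d δ η) ≤ C * η := by
  have := nontrivial_space hd
  set V := volume.real (ball (0 : Space d) 1)
  refine ⟨2 * d * (2 * δ) ^ (d - 1) * V, by positivity, fun η hη hηδ => ?_⟩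
  have hv : ∀ r : ℝ, 0 ≤ r → volume.real (ball (0 : Space d) r) = r ^ d * V := by
    intro r hr
    rw [measureReal_def, Measure.addHaar_ball _ _ hr, ENNReal.toReal_mul,
      ENNReal.toReal_ofReal (by positivity), finrank_euclideanSpace_fin]
    rfl
  rw [annulus, measureReal_sdiff (ball_subset_ball (by linarith)) measurableSet_ball,
    hv _ (by linarith), hv _ (by linarith), ← sub_mul]
  have h1 := abs_pow_sub_pow_le (δ + η) (δ - η) d
  have h2 : max |δ + η| |δ - η| ≤ 2 * δ := by
    rw [abs_of_pos (by linarith), abs_of_pos (by linarith)]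
    exact max_le (by linarith) (by linarith)
  have h3 : |δ + η - (δ - η)| = 2 * η := by rw [abs_of_pos (by linarith)]; ring
  have h4 : (δ + η) ^ d - (δ - η) ^ d ≤ 2 * η * d * (2 * δ) ^ (d - 1) := by
    refine (le_abs_self _).trans (h1.trans ?_)
    rw [h3]
    gcongr
  calc _ ≤ (2 * η * d * (2 * δ) ^ (d - 1)) * V := by gcongr
    _ = _ := by ring

theorem volume_annulus_ne_top (δ η : ℝ) : volume (annulus d δ η) ≠ ⊤ :=
  ((measure_mono Set.sdiff_subset).trans_lt measure_ball_lt_top).ne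

/-! ### Elementary estimates for negative powers -/

theorem abs_rpow_sub_one_le {s c : ℝ} (hs : 0 ≤ s) (hc : 0 < c) (hc1 : c ≤ 1) :
    ∃ K : ℝ, 0 ≤ K ∧ ∀ u : ℝ, c ≤ u → |u ^ (-s) - 1| ≤ K * |u - 1| := by
  refine ⟨s * c ^ (-s - 1), by positivity, fun u hu => ?_⟩
  have h := Convex.norm_image_sub_le_of_norm_hasDerivWithin_le (s := Set.Ici c)
    (f := fun u : ℝ => u ^ (-s)) (f' := fun u => -s * u ^ (-s - 1)) (C := s * c ^ (-s - 1))
    (x := 1) (y := u) (fun x hx => (Real.hasDerivAt_rpow_const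
      (Or.inl (hc.trans_le hx).ne')).hasDerivWithinAt) (fun x hx => ?_) (convex_Ici c) hc1 hu
  · simpa [Real.norm_eq_abs] using h
  · have hx0 : 0 < x := hc.trans_le hx
    rw [norm_mul, norm_neg, Real.norm_of_nonneg hs, Real.norm_of_nonneg (by positivity)]
    exact mul_le_mul_of_nonneg_left (Real.rpow_le_rpow_of_nonpos hc hx (by linarith)) hs

/-- The function `u^{-σ} + σu` has derivative `σ(1 - u^{-σ-1})`, which is `O(|u - 1|)` by the
preceding first-order bound; the mean value inequality between `1` and `u` gives the square. -/
theorem abs_rpow_sub_linear_le {σ c : ℝ} (hσ : 0 ≤ σ) (hc : 0 < c) (hc1 : c ≤ 1) :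
    ∃ K : ℝ, 0 ≤ K ∧ ∀ u : ℝ, c ≤ u → |u ^ (-σ) - 1 + σ * (u - 1)| ≤ K * (u - 1) ^ 2 := by
  obtain ⟨K, hK0, hK⟩ := abs_rpow_sub_one_le (s := σ + 1) (by linarith) hc hc1
  refine ⟨σ * K, by positivity, fun u hu => ?_⟩
  have hsub : ∀ x ∈ Set.uIcc 1 u, c ≤ x ∧ |x - 1| ≤ |u - 1| := by
    intro x hx
    refine ⟨(le_min hc1 hu).trans hx.1, Set.abs_sub_left_of_mem_uIcc hx⟩
  have h := Convex.norm_image_sub_le_of_norm_hasDerivWithin_le (s := Set.uIcc 1 u)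
    (f := fun u : ℝ => u ^ (-σ) + σ * u) (f' := fun u => -σ * u ^ (-σ - 1) + σ * 1)
    (C := σ * (K * |u - 1|))
    (x := 1) (y := u) (fun x hx => ((Real.hasDerivAt_rpow_const
      (Or.inl (hc.trans_le (hsub x hx).1).ne')).add
        ((hasDerivAt_id x).const_mul σ)).hasDerivWithinAt)
    (fun x hx => ?_) (convex_uIcc 1 u) Set.left_mem_uIcc Set.right_mem_uIcc
  · rw [Real.norm_eq_abs, Real.norm_eq_abs] at h
    have e : u ^ (-σ) + σ * u - ((1 : ℝ) ^ (-σ) + σ * 1) = u ^ (-σ) - 1 + σ * (u - 1) := by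
      rw [Real.one_rpow]; ring
    rw [e] at h
    refine h.trans (le_of_eq ?_)
    rw [← sq_abs (u - 1)]; ring
  · have e : -σ * x ^ (-σ - 1) + σ * 1 = -(σ * (x ^ (-(σ + 1)) - 1)) := by
      rw [show -σ - 1 = -(σ + 1) by ring]; ring
    rw [e, norm_neg, norm_mul, Real.norm_of_nonneg hσ, Real.norm_eq_abs]
    gcongr
    exact (hK x (hsub x hx).1).trans (mul_le_mul_of_nonneg_left (hsub x hx).2 hK0)

/-! ### Lattice Riemann sums of singular functions -/

theorem mem_nbrs_zero {X : Set (Space d)} {δ : ℝ} {y : Space d} :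
    y ∈ nbrs X δ 0 ↔ y ∈ X ∧ ‖y‖ < δ ∧ y ≠ 0 := by
  simp [nbrs, and_assoc]

/-- Sum and integral are written as the integral of one function of `z`, including the linear term
of zero mean, so a pointwise majorant `H` suffices. The hypotheses separate the cases where `z` and
its rounding lie on the same or on opposite sides of the sphere, and the cell of the origin, which
the sum omits. -/
theorem riemann_error_le {h δ : ℝ} (hh : 0 < h) (F a H : Space d → ℝ)
    (hF : IntegrableOn F (ball 0 δ)) (hH : Integrable H) (hH0 : ∀ z, 0 ≤ H z)
    (hin : ∀ z, ‖z‖ < δ → snap h z ≠ 0 → ‖snap h z‖ < δ →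
      |F (snap h z) + a (snap h z) * inner ℝ (snap h z) (z - snap h z) - F z| ≤ H z)
    (hzero : ∀ z, ‖z‖ < δ → snap h z = 0 → |F z| ≤ H z)
    (hout : ∀ z, ‖z‖ < δ → δ ≤ ‖snap h z‖ → |F z| ≤ H z)
    (hout' : ∀ z, δ ≤ ‖z‖ → ‖snap h z‖ < δ → snap h z ≠ 0 →
      |F (snap h z) + a (snap h z) * inner ℝ (snap h z) (z - snap h z)| ≤ H z) :
    |h ^ d * (∑ᶠ y ∈ nbrs (lattice d h) δ 0, F y) - ∫ z in ball 0 δ, F z| ≤ ∫ z, H z := by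
  classical
  have hfin := nbrs_finite hh (X := lattice d h) subset_rfl δ (0 : Space d)
  set S := hfin.toFinset with hSdef
  have hS : ∀ y ∈ S, y ∈ lattice d h := fun y hy => (mem_nbrs_zero.1 (hfin.mem_toFinset.1 hy)).1
  have hmem : ∀ z, snap h z ∈ S ↔ ‖snap h z‖ < δ ∧ snap h z ≠ 0 := by
    intro z
    rw [hSdef, hfin.mem_toFinset, mem_nbrs_zero]
    exact and_iff_right (snap_mem_lattice h z)
  have e1 : ∑ᶠ y ∈ nbrs (lattice d h) δ 0, F y = ∑ y ∈ S, F y := by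
    rw [finsum_mem_eq_finite_toFinset_sum _ hfin]
  have i1 := integrable_comp_snap hh hS F
  have i2 := integrable_linear_snap hh hS a
  have i3 := (integrable_indicator_iff measurableSet_ball).2 hF
  have key : h ^ d * (∑ᶠ y ∈ nbrs (lattice d h) δ 0, F y) - ∫ z in ball 0 δ, F z =
      ∫ z, ((if snap h z ∈ S then F (snap h z) else 0) +
        (if snap h z ∈ S then a (snap h z) * inner ℝ (snap h z) (z - snap h z) else 0) -
        (ball 0 δ).indicator F z) := by
    have i4 : Integrable fun z => (if snap h z ∈ S then F (snap h z) else 0) +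
        (if snap h z ∈ S then a (snap h z) * inner ℝ (snap h z) (z - snap h z) else 0) := i1.add i2
    rw [integral_sub i4 i3, integral_add i1 i2, integral_comp_snap hh hS,
      integral_linear_snap hh hS, integral_indicator measurableSet_ball, e1, add_zero]
  rw [key, ← Real.norm_eq_abs]
  refine norm_integral_le_of_norm_le hH (Filter.Eventually.of_forall fun z => ?_)
  rw [Real.norm_eq_abs]
  by_cases hz : ‖z‖ < δ
  · rw [Set.indicator_of_mem (by simpa using hz)]
    by_cases hT : snap h z ∈ S
    · simp only [if_pos hT]
      exact hin z hz ((hmem z).1 hT).2 ((hmem z).1 hT).1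
    · simp only [if_neg hT, add_zero, zero_sub, abs_neg]
      by_cases h0 : snap h z = 0
      · exact hzero z hz h0
      · exact hout z hz (not_lt.1 fun hc => hT ((hmem z).2 ⟨hc, h0⟩))
  · rw [Set.indicator_of_notMem (by simpa using hz), sub_zero]
    by_cases hT : snap h z ∈ S
    · simp only [if_pos hT]
      exact hout' z (not_lt.1 hz) ((hmem z).1 hT).1 ((hmem z).1 hT).2
    · simpa [if_neg hT] using hH0 z

theorem mem_annulus_of_snap {h δ : ℝ} (hh : 0 < h) (hd : 0 < d) {z : Space d}
    (hz : (‖z‖ < δ ∧ δ ≤ ‖snap h z‖) ∨ (δ ≤ ‖z‖ ∧ ‖snap h z‖ < δ)) :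
    z ∈ annulus d δ (d * h) ∧ δ - d * h ≤ ‖snap h z‖ := by
  have h1 := norm_sub_snap_le hh z
  have hdh : 0 < (d : ℝ) * h := by positivity
  have h2 := abs_le.1 (abs_norm_sub_norm_le z (snap h z))
  simp only [annulus, Set.mem_sdiff, mem_ball_zero_iff, not_lt]
  rcases hz with ⟨h3, h4⟩ | ⟨h3, h4⟩ <;> refine ⟨⟨?_, ?_⟩, ?_⟩ <;> linarith [h2.1, h2.2]

theorem integrable_indicator_annulus (δ η B : ℝ) :
    Integrable ((annulus d δ η).indicator fun _ => B) :=
  (integrable_indicator_iff (measurableSet_annulus δ η)).2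
    (integrableOn_const (volume_annulus_ne_top δ η))

theorem integral_indicator_annulus (δ η B : ℝ) :
    ∫ z, (annulus d δ η).indicator (fun _ => B) z = volume.real (annulus d δ η) * B := by
  rw [integral_indicator (measurableSet_annulus δ η), setIntegral_const, smul_eq_mul]

/-- Since `g` vanishes at the origin, `|g(z)| ≤ G|z|` absorbs the factor `1/|z|` lost when
`|z|^{-s}` is compared with its value at the rounded point. What remains is `h|z|^{-s}`, integrable,
plus a boundary layer of volume `O(h)`. -/
theorem riemann_lipschitz (hd : 0 < d) {s δ : ℝ} (hs0 : 0 ≤ s) (hsd : s < d) (hδ : 0 < δ) :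
    ∃ C h₁ : ℝ, 0 ≤ C ∧ 0 < h₁ ∧ ∀ h : ℝ, 0 < h → h < h₁ → ∀ G : ℝ, 0 ≤ G →
      ∀ g : Space d → ℝ, g 0 = 0 →
      (∀ y ∈ ball (0 : Space d) δ, ∀ z ∈ ball (0 : Space d) δ, |g y - g z| ≤ G * ‖y - z‖) →
      |h ^ d * (∑ᶠ y ∈ nbrs (lattice d h) δ 0, g y * ‖y‖ ^ (-s)) -
        ∫ z in ball 0 δ, g z * ‖z‖ ^ (-s)| ≤ C * G * h := by
  have hd' : (0 : ℝ) < d := by exact_mod_cast hd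
  set L : ℝ := d + 1 with hL
  have hL0 : 0 < L := by positivity
  obtain ⟨K, hK0, hK⟩ := abs_rpow_sub_one_le (s := s) (c := L⁻¹) hs0 (by positivity)
    (inv_le_one_of_one_le₀ (by linarith))
  obtain ⟨Cv, hCv0, hCv⟩ := volume_annulus_le (d := d) hd hδ
  set I := ∫ z in ball (0 : Space d) δ, ‖z‖ ^ (-s) with hI
  have hI0 : 0 ≤ I := integral_nonneg fun z => by positivity
  set C0 : ℝ := d * (L ^ s + K + 1) with hC0
  have hC00 : 0 ≤ C0 := by positivity
  set B : ℝ := δ * (δ / 2) ^ (-s) with hB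
  have hB0 : 0 ≤ B := by positivity
  -- `h < δ/(2d)` keeps the boundary layer of half-width `d h` outside the ball of radius `δ/2`,
  -- where `G * B` bounds the integrand.
  refine ⟨C0 * I + Cv * d * B, δ / (2 * d), by positivity, by positivity,
    fun h hh hh1 G hG g hg0 hg => ?_⟩
  have hdh : d * h < δ / 2 := by
    rw [lt_div_iff₀ (by positivity)] at hh1; linarith
  have hgz : ∀ z : Space d, ‖z‖ < δ → |g z| ≤ G * ‖z‖ := by
    intro z hz
    simpa [hg0] using hg z (by simpa using hz) 0 (by simpa using hδ)
  have hFB : ∀ z : Space d, ‖z‖ < δ → δ / 2 ≤ ‖z‖ → |g z * ‖z‖ ^ (-s)| ≤ G * B := by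
    intro z hz hz2
    have h1 : ‖z‖ ^ (-s) ≤ (δ / 2) ^ (-s) :=
      Real.rpow_le_rpow_of_nonpos (by positivity) hz2 (by linarith)
    rw [abs_mul, abs_of_nonneg (show 0 ≤ ‖z‖ ^ (-s) by positivity)]
    calc |g z| * ‖z‖ ^ (-s) ≤ (G * δ) * (δ / 2) ^ (-s) := by
          gcongr
          exact (hgz z hz).trans (by gcongr)
      _ = _ := by rw [hB]; ring
  have hInt := integrableOn_norm_rpow_ball (d := d) hd hsd δ
  set H : Space d → ℝ := fun z => (ball (0 : Space d) δ).indicator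
    (fun z => C0 * G * h * ‖z‖ ^ (-s)) z +
      (annulus d δ (d * h)).indicator (fun _ => G * B) z with hHdef
  have hH1 : Integrable ((ball (0 : Space d) δ).indicator
      (fun z => C0 * G * h * ‖z‖ ^ (-s))) :=
    (integrable_indicator_iff measurableSet_ball).2 (hInt.const_mul _)
  have hH2 := integrable_indicator_annulus (d := d) δ (d * h) (G * B)
  have hpos1 : ∀ z, 0 ≤ (ball (0 : Space d) δ).indicator
      (fun z => C0 * G * h * ‖z‖ ^ (-s)) z :=
    fun z => Set.indicator_nonneg (fun z _ => by positivity) z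
  have hpos2 : ∀ z, 0 ≤ (annulus d δ (d * h)).indicator (fun _ => G * B) z :=
    fun z => Set.indicator_nonneg (fun z _ => by positivity) z
  have hHin : ∀ z : Space d, ‖z‖ < δ → C0 * G * h * ‖z‖ ^ (-s) ≤ H z := by
    intro z hz
    have := hpos2 z
    simp only [hHdef]
    rw [Set.indicator_of_mem (show z ∈ ball (0 : Space d) δ by simpa using hz)]
    linarith
  have hHann : ∀ z ∈ annulus d δ (d * h), G * B ≤ H z := by
    intro z hz
    have := hpos1 z
    simp only [hHdef]
    rw [Set.indicator_of_mem hz]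
    linarith
  have hFint : IntegrableOn (fun z => g z * ‖z‖ ^ (-s)) (ball (0 : Space d) δ) := by
    have hcont : ContinuousOn g (ball 0 δ) := by
      have : LipschitzOnWith (Real.toNNReal G) g (ball 0 δ) := by
        refine LipschitzOnWith.of_dist_le_mul fun y hy z hz => ?_
        rw [Real.dist_eq, dist_eq_norm, Real.coe_toNNReal G hG]
        exact hg y hy z hz
      exact this.continuousOn
    refine Integrable.mono' (hInt.const_mul (G * δ))
      ((hcont.aestronglyMeasurable measurableSet_ball).mul
        (measurable_norm.pow_const _).aestronglyMeasurable) ?_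
    refine (ae_restrict_iff' measurableSet_ball).2 (Filter.Eventually.of_forall fun z hz => ?_)
    have hz' : ‖z‖ < δ := by simpa using hz
    rw [norm_mul, Real.norm_eq_abs, Real.norm_of_nonneg (show 0 ≤ ‖z‖ ^ (-s) by positivity)]
    gcongr
    exact (hgz z hz').trans (by gcongr)
  have main := riemann_error_le hh (fun z => g z * ‖z‖ ^ (-s)) (fun _ => 0) H hFint
    (hH1.add hH2) (fun z => add_nonneg (hpos1 z) (hpos2 z)) ?_ ?_ ?_ ?_
  · refine main.trans ?_
    have : ∫ z, H z = C0 * G * h * I + volume.real (annulus d δ (d * h)) * (G * B) := by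
      simp only [hHdef]
      rw [integral_add hH1 hH2, integral_indicator measurableSet_ball, integral_const_mul,
        integral_indicator_annulus]
    rw [this]
    have hv := hCv (d * h) (by positivity) (by linarith)
    calc C0 * G * h * I + volume.real (annulus d δ (d * h)) * (G * B)
        ≤ C0 * G * h * I + Cv * (d * h) * (G * B) := by gcongr
      _ = _ := by ring
  · intro z hz hT hTδ
    refine le_trans ?_ (hHin z hz)
    have hz0 : 0 < ‖z‖ := lt_of_lt_of_le (by positivity) (half_le_norm_of_snap_ne hh hT)
    have hdist : ‖snap h z - z‖ ≤ d * h := by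
      rw [norm_sub_rev]
      refine (norm_sub_snap_le hh z).trans ?_
      gcongr; linarith
    set w := snap h z
    have hw0 : 0 < ‖w‖ := norm_pos_iff.2 hT
    have hu : L⁻¹ ≤ ‖w‖ / ‖z‖ := by
      rw [le_div_iff₀ hz0, inv_mul_le_iff₀ hL0]
      exact norm_le_snap hh hT
    have hu0 : 0 < ‖w‖ / ‖z‖ := by positivity
    have hsplit : ‖w‖ ^ (-s) = (‖w‖ / ‖z‖) ^ (-s) * ‖z‖ ^ (-s) := by
      rw [← Real.mul_rpow hu0.le hz0.le, div_mul_cancel₀ _ hz0.ne']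
    have hub : (‖w‖ / ‖z‖) ^ (-s) ≤ L ^ s := by
      calc (‖w‖ / ‖z‖) ^ (-s) ≤ (L⁻¹) ^ (-s) :=
            Real.rpow_le_rpow_of_nonpos (by positivity) hu (by linarith)
        _ = L ^ s := by rw [Real.rpow_neg (by positivity), Real.inv_rpow hL0.le, inv_inv]
    have hu1 : |‖w‖ / ‖z‖ - 1| ≤ d * h / ‖z‖ := by
      rw [div_sub_one hz0.ne', abs_div, abs_of_pos hz0]
      gcongr
      exact (abs_norm_sub_norm_le w z).trans hdist
    have h1 : |(g w - g z) * ((‖w‖ / ‖z‖) ^ (-s))| ≤ G * (d * h) * L ^ s := by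
      rw [abs_mul, abs_of_nonneg (show 0 ≤ (‖w‖ / ‖z‖) ^ (-s) by positivity)]
      gcongr
      exact (hg w (by simpa using hTδ) z (by simpa using hz)).trans (by gcongr)
    have h2 : |g z * ((‖w‖ / ‖z‖) ^ (-s) - 1)| ≤ G * (d * h) * K := by
      rw [abs_mul]
      calc |g z| * |(‖w‖ / ‖z‖) ^ (-s) - 1| ≤ (G * ‖z‖) * (K * (d * h / ‖z‖)) := by
            refine mul_le_mul (hgz z hz) ((hK _ hu).trans ?_) (abs_nonneg _) (by positivity)
            gcongr
        _ = _ := by field_simp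
    have e : g w * ‖w‖ ^ (-s) + 0 * inner ℝ w (z - w) - g z * ‖z‖ ^ (-s) =
        ((g w - g z) * ((‖w‖ / ‖z‖) ^ (-s)) + g z * ((‖w‖ / ‖z‖) ^ (-s) - 1)) * ‖z‖ ^ (-s) := by
      rw [hsplit]; ring
    rw [e, abs_mul, abs_of_nonneg (show 0 ≤ ‖z‖ ^ (-s) by positivity)]
    gcongr
    refine (abs_add_le _ _).trans ((add_le_add h1 h2).trans ?_)
    rw [hC0]
    nlinarith [show 0 ≤ G * (d * h) by positivity]
  · intro z hz hT
    refine le_trans ?_ (hHin z hz)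
    have hdist := norm_sub_snap_le hh z
    rw [hT, sub_zero] at hdist
    rw [abs_mul, abs_of_nonneg (show 0 ≤ ‖z‖ ^ (-s) by positivity)]
    gcongr
    calc |g z| ≤ G * ‖z‖ := hgz z hz
      _ ≤ G * (d * (h / 2)) := by gcongr
      _ ≤ G * (d * h) * 1 := by rw [mul_one]; gcongr; linarith
      _ ≤ G * (d * h) * (L ^ s + K + 1) := by
          gcongr
          have : 0 ≤ L ^ s := by positivity
          linarith
      _ = _ := by rw [hC0]; ring
  · intro z hz hT
    obtain ⟨h1, _⟩ := mem_annulus_of_snap hh hd (Or.inl ⟨hz, hT⟩)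
    refine (hFB z hz ?_).trans (hHann z h1)
    have : δ - d * h ≤ ‖z‖ := by simpa using h1.2
    linarith
  · intro z hz hT _
    obtain ⟨h1, h2⟩ := mem_annulus_of_snap hh hd (Or.inr ⟨hz, hT⟩)
    rw [zero_mul, add_zero]
    exact (hFB _ hT (by linarith)).trans (hHann z h1)

/-- With `w` the rounded point, `t = z - w` and `u = |z|²/|w|²`, one has `|z|^{-s} = |w|^{-s}
u^{-s/2}`, and `u - 1 = (2⟨w,t⟩ + |t|²)/|w|²` exactly. A one-variable expansion at `u = 1` then
produces the linear term, and all else is of order `|t|²/|w|²`. -/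
theorem norm_rpow_taylor (hd : 0 < d) {s : ℝ} (hs0 : 0 ≤ s) :
    ∃ C : ℝ, 0 ≤ C ∧ ∀ h : ℝ, 0 < h → ∀ z : Space d, snap h z ≠ 0 →
      |‖snap h z‖ ^ (-s) + -s * ‖snap h z‖ ^ (-(s + 2)) * inner ℝ (snap h z) (z - snap h z) -
        ‖z‖ ^ (-s)| ≤ C * h ^ 2 * ‖z‖ ^ (-(s + 2)) := by
  have hd' : (0 : ℝ) < d := by exact_mod_cast hd
  set L : ℝ := d + 1 with hL
  have hL0 : 0 < L := by positivity
  -- `L⁻²` is the lower bound for `u` coming from `snap_norm_le`.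
  obtain ⟨K, hK0, hK⟩ := abs_rpow_sub_linear_le (σ := s / 2) (c := (L ^ 2)⁻¹) (by positivity)
    (by positivity) (inv_le_one_of_one_le₀ (one_le_pow₀ (by linarith)))
  refine ⟨(K * (2 + d) ^ 2 + s / 2) * d ^ 2 * L ^ (s + 2), by positivity, fun h hh z hT => ?_⟩
  have hz0 : 0 < ‖z‖ := lt_of_lt_of_le (by positivity) (half_le_norm_of_snap_ne hh hT)
  have hdist : ‖z - snap h z‖ ≤ d * h :=
    (norm_sub_snap_le hh z).trans (by gcongr; linarith)
  have hhw : h ≤ ‖snap h z‖ := by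
    obtain ⟨i, hi⟩ := le_norm_of_mem_lattice hh (snap_mem_lattice h z) hT
    exact hi.trans (abs_apply_le_norm _ i)
  have hzw := norm_le_snap hh hT
  have hwz := snap_norm_le hh hT
  set w := snap h z
  set t := z - w with ht
  have hw0 : 0 < ‖w‖ := norm_pos_iff.2 hT
  have hztw : z = w + t := by rw [ht]; abel
  have hnorm : ‖z‖ ^ 2 = ‖w‖ ^ 2 + 2 * inner ℝ w t + ‖t‖ ^ 2 := by
    rw [hztw]; exact norm_add_sq_real w t
  set u : ℝ := ‖z‖ ^ 2 / ‖w‖ ^ 2 with hu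
  have hu1 : u - 1 = (2 * inner ℝ w t + ‖t‖ ^ 2) / ‖w‖ ^ 2 := by
    rw [hu, hnorm]; field_simp; ring
  have huc : (L ^ 2)⁻¹ ≤ u := by
    rw [hu, le_div_iff₀ (by positivity), inv_mul_le_iff₀ (by positivity), ← mul_pow]
    gcongr
  have hfz : ‖z‖ ^ (-s) = ‖w‖ ^ (-s) * u ^ (-(s / 2)) := by
    have e1 : ∀ a : ℝ, 0 ≤ a → a ^ (-s) = (a ^ 2) ^ (-(s / 2)) := by
      intro a ha
      rw [← Real.rpow_natCast, ← Real.rpow_mul ha]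
      congr 1
      push_cast; ring
    rw [e1 _ hz0.le, e1 _ hw0.le, ← Real.mul_rpow (by positivity) (by positivity), hu,
      mul_div_cancel₀ _ (by positivity)]
  have hf2 : ‖w‖ ^ (-(s + 2)) = ‖w‖ ^ (-s) / ‖w‖ ^ 2 := by
    rw [neg_add, Real.rpow_add hw0, Real.rpow_neg hw0.le 2, ← div_eq_mul_inv]
    norm_cast
  have htw : ‖t‖ ≤ d * ‖w‖ := hdist.trans (by gcongr)
  have hub : |u - 1| ≤ (2 + d) * ‖t‖ / ‖w‖ := by
    rw [hu1, abs_div, abs_of_pos (show 0 < ‖w‖ ^ 2 by positivity), div_le_div_iff₀ (by positivity)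
      hw0]
    have h1 : |2 * inner ℝ w t + ‖t‖ ^ 2| ≤ 2 * (‖w‖ * ‖t‖) + d * ‖w‖ * ‖t‖ := by
      refine (abs_add_le _ _).trans (add_le_add ?_ ?_)
      · rw [abs_mul, abs_two]
        gcongr
        exact abs_real_inner_le_norm w t
      · rw [abs_of_nonneg (by positivity), sq]
        gcongr
    calc |2 * inner ℝ w t + ‖t‖ ^ 2| * ‖w‖ ≤ (2 * (‖w‖ * ‖t‖) + d * ‖w‖ * ‖t‖) * ‖w‖ := by gcongr
      _ = _ := by ring
  have hrem : |u ^ (-(s / 2)) - 1 + s / 2 * (u - 1) - s / 2 * (‖t‖ ^ 2 / ‖w‖ ^ 2)| ≤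
      (K * (2 + d) ^ 2 + s / 2) * (‖t‖ ^ 2 / ‖w‖ ^ 2) := by
    have h1 : (u - 1) ^ 2 ≤ (2 + d) ^ 2 * (‖t‖ ^ 2 / ‖w‖ ^ 2) := by
      rw [← sq_abs]
      calc |u - 1| ^ 2 ≤ ((2 + d) * ‖t‖ / ‖w‖) ^ 2 := by gcongr
        _ = _ := by ring
    have h2 := hK u huc
    have h3 : K * (u - 1) ^ 2 ≤ K * ((2 + d) ^ 2 * (‖t‖ ^ 2 / ‖w‖ ^ 2)) := by gcongr
    refine (abs_sub _ _).trans ?_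
    rw [abs_of_nonneg (show 0 ≤ s / 2 * (‖t‖ ^ 2 / ‖w‖ ^ 2) by positivity)]
    linarith
  have e : ‖w‖ ^ (-s) + -s * ‖w‖ ^ (-(s + 2)) * inner ℝ w t - ‖z‖ ^ (-s) =
      -(‖w‖ ^ (-s) * (u ^ (-(s / 2)) - 1 + s / 2 * (u - 1) - s / 2 * (‖t‖ ^ 2 / ‖w‖ ^ 2))) := by
    rw [hu1, hf2, hfz]
    field_simp
    ring
  rw [e, abs_neg, abs_mul, abs_of_nonneg (show 0 ≤ ‖w‖ ^ (-s) by positivity)]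
  have hw2 : ‖w‖ ^ (-(s + 2)) ≤ L ^ (s + 2) * ‖z‖ ^ (-(s + 2)) := by
    calc ‖w‖ ^ (-(s + 2)) ≤ (‖z‖ / L) ^ (-(s + 2)) :=
          Real.rpow_le_rpow_of_nonpos (by positivity)
            ((div_le_iff₀ hL0).2 (by linarith)) (by linarith)
      _ = _ := by
        rw [Real.div_rpow hz0.le hL0.le, Real.rpow_neg hL0.le, div_inv_eq_mul, mul_comm]
  calc ‖w‖ ^ (-s) * |u ^ (-(s / 2)) - 1 + s / 2 * (u - 1) - s / 2 * (‖t‖ ^ 2 / ‖w‖ ^ 2)|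
      ≤ ‖w‖ ^ (-s) * ((K * (2 + d) ^ 2 + s / 2) * (‖t‖ ^ 2 / ‖w‖ ^ 2)) := by gcongr
    _ = (K * (2 + d) ^ 2 + s / 2) * ‖t‖ ^ 2 * ‖w‖ ^ (-(s + 2)) := by rw [hf2]; ring
    _ ≤ (K * (2 + d) ^ 2 + s / 2) * (d * h) ^ 2 * (L ^ (s + 2) * ‖z‖ ^ (-(s + 2))) := by
        gcongr
    _ = _ := by ring

/-- This is the source of the exponent `min(1, d - s)`. Without a vanishing factor at the origin,
the error has three contributions: the second-order Taylor remainder away from the origin (`H1`),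
the integral over the omitted central cell (`H2`), and the boundary layer (`H3`). -/
theorem riemann_norm_rpow {s : ℝ} (hs0 : 0 ≤ s) (hsd : s < d) :
    ∃ C h₁ : ℝ, 0 ≤ C ∧ 0 < h₁ ∧ ∀ h : ℝ, 0 < h → h < h₁ →
      |h ^ d * (∑ᶠ y ∈ nbrs (lattice d h) 1 0, ‖y‖ ^ (-s)) -
        ∫ z in ball (0 : Space d) 1, ‖z‖ ^ (-s)| ≤ C * h ^ min 1 ((d : ℝ) - s) := by
  have hd' : (0 : ℝ) < d := hs0.trans_lt hsd
  have hd : 0 < d := by exact_mod_cast hd'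
  obtain ⟨C1, hC10, hC1⟩ := norm_rpow_taylor hd hs0
  obtain ⟨C2, hC20, hC2⟩ := sq_mul_setIntegral_hollowBall_le hd (s := s)
  obtain ⟨Cv, hCv0, hCv⟩ := volume_annulus_le (d := d) hd one_pos
  set I := ∫ z in ball (0 : Space d) 1, ‖z‖ ^ (-s) with hI
  have hI0 : 0 ≤ I := integral_nonneg fun z => by positivity
  set B : ℝ := 2 ^ s + s * 2 ^ (s + 2) with hB
  have hB0 : 0 ≤ B := by positivity
  set α := min 1 ((d : ℝ) - s) with hα
  have hα0 : 0 < α := lt_min one_pos (by linarith)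
  refine ⟨C1 * C2 + d ^ ((d : ℝ) - s) * I + Cv * d * B, 1 / (2 * d), by positivity,
    by positivity, fun h hh hh1 => ?_⟩
  have hdh : d * h < 1 / 2 := by
    rw [lt_div_iff₀ (by positivity)] at hh1; linarith
  have hh1' : h < 1 := by
    have : (1 : ℝ) ≤ d := by exact_mod_cast hd
    nlinarith
  have hInt := integrableOn_norm_rpow_ball (d := d) hd hsd
  set H1 : Space d → ℝ := (hollowBall d h).indicator
    (fun z => C1 * h ^ 2 * ‖z‖ ^ (-(s + 2))) with hH1
  set H2 : Space d → ℝ := (ball (0 : Space d) (d * h)).indicator (fun z => ‖z‖ ^ (-s)) with hH2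
  set H3 : Space d → ℝ := (annulus d 1 (d * h)).indicator (fun _ => B) with hH3
  have i1 : Integrable H1 := (integrable_indicator_iff (measurableSet_hollowBall h)).2
    ((integrableOn_norm_rpow_hollowBall _ hh).const_mul _)
  have i2 : Integrable H2 := (integrable_indicator_iff measurableSet_ball).2 (hInt _)
  have i3 : Integrable H3 := integrable_indicator_annulus _ _ _
  have p1 : ∀ z, 0 ≤ H1 z := fun z => Set.indicator_nonneg (fun z _ => by positivity) z
  have p2 : ∀ z, 0 ≤ H2 z := fun z => Set.indicator_nonneg (fun z _ => by positivity) z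
  have p3 : ∀ z, 0 ≤ H3 z := fun z => Set.indicator_nonneg (fun z _ => by positivity) z
  have hpow : ∀ (σ : ℝ), 0 ≤ σ → ∀ w : Space d, 1 / 2 ≤ ‖w‖ → ‖w‖ ^ (-σ) ≤ 2 ^ σ := by
    intro σ hσ w hw
    calc ‖w‖ ^ (-σ) ≤ (1 / 2 : ℝ) ^ (-σ) :=
          Real.rpow_le_rpow_of_nonpos (by norm_num) hw (by linarith)
      _ = 2 ^ σ := by rw [one_div, Real.rpow_neg (by norm_num), Real.inv_rpow (by norm_num), inv_inv]
  have main := riemann_error_le hh (δ := 1) (fun z => ‖z‖ ^ (-s))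
    (fun w => -s * ‖w‖ ^ (-(s + 2))) (fun z => H1 z + H2 z + H3 z) (hInt 1) ((i1.add i2).add i3)
    (fun z => add_nonneg (add_nonneg (p1 z) (p2 z)) (p3 z)) ?_ ?_ ?_ ?_
  · refine main.trans ?_
    have i4 : Integrable fun z => H1 z + H2 z := i1.add i2
    rw [integral_add i4 i3, integral_add i1 i2, hH1, hH2, hH3,
      integral_indicator (measurableSet_hollowBall h), integral_const_mul,
      integral_indicator measurableSet_ball, integral_indicator_annulus,
      setIntegral_norm_rpow_ball (by positivity), ← hI]
    have b1 := hC2 h hh hh1'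
    have b2 : (d * h : ℝ) ^ ((d : ℝ) - s) ≤ d ^ ((d : ℝ) - s) * h ^ α := by
      rw [Real.mul_rpow hd'.le hh.le]
      gcongr ?_ * ?_
      exact Real.rpow_le_rpow_of_exponent_ge hh hh1'.le (min_le_right _ _)
    have b3 := hCv (d * h) (by positivity) (by linarith)
    have b4 : h ≤ h ^ α := by
      simpa using Real.rpow_le_rpow_of_exponent_ge hh hh1'.le (min_le_left 1 ((d : ℝ) - s))
    calc C1 * h ^ 2 * (∫ z in hollowBall d h, ‖z‖ ^ (-(s + 2))) + (d * h : ℝ) ^ ((d : ℝ) - s) * I +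
          volume.real (annulus d 1 (d * h)) * B
        = C1 * (h ^ 2 * (∫ z in hollowBall d h, ‖z‖ ^ (-(s + 2)))) +
          (d * h : ℝ) ^ ((d : ℝ) - s) * I + volume.real (annulus d 1 (d * h)) * B := by ring
      _ ≤ C1 * (C2 * h ^ α) + (d ^ ((d : ℝ) - s) * h ^ α) * I + (Cv * (d * h ^ α)) * B := by
          gcongr
          exact b3.trans (by gcongr)
      _ = _ := by ring
  · intro z hz hT _
    have hz2 := half_le_norm_of_snap_ne hh hT
    have : H1 z = C1 * h ^ 2 * ‖z‖ ^ (-(s + 2)) :=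
      Set.indicator_of_mem (show z ∈ hollowBall d h by
        simp only [hollowBall, Set.mem_sdiff, mem_ball_zero_iff, not_lt]; exact ⟨hz, hz2⟩) _
    have := hC1 h hh z hT
    linarith [p2 z, p3 z]
  · intro z hz hT
    have hdist := norm_sub_snap_le hh z
    rw [hT, sub_zero] at hdist
    have : H2 z = ‖z‖ ^ (-s) := Set.indicator_of_mem (by
      rw [mem_ball_zero_iff]; nlinarith) _
    rw [abs_of_nonneg (by positivity)]
    linarith [p1 z, p3 z]
  · intro z hz hT
    obtain ⟨h1, _⟩ := mem_annulus_of_snap hh hd (Or.inl ⟨hz, hT⟩)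
    have h3 : 1 - d * h ≤ ‖z‖ := by simpa using h1.2
    have : H3 z = B := Set.indicator_of_mem h1 _
    have h4 := hpow s hs0 z (by linarith)
    have : 0 ≤ s * (2 : ℝ) ^ (s + 2) := by positivity
    rw [abs_of_nonneg (by positivity)]
    linarith [p1 z, p2 z]
  · intro z hz hT hT0
    obtain ⟨h1, h2⟩ := mem_annulus_of_snap hh hd (Or.inr ⟨hz, hT⟩)
    have : H3 z = B := Set.indicator_of_mem h1 _
    have hdist : ‖z - snap h z‖ ≤ 1 := (norm_sub_snap_le hh z).trans (by nlinarith)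
    have h4 := hpow s hs0 (snap h z) (by linarith)
    have h5 := hpow (s + 2) (by linarith) (snap h z) (by linarith)
    have h6 : |-s * ‖snap h z‖ ^ (-(s + 2)) * inner ℝ (snap h z) (z - snap h z)| ≤
        s * 2 ^ (s + 2) := by
      rw [abs_mul, abs_mul, abs_neg, abs_of_nonneg hs0,
        abs_of_nonneg (show 0 ≤ ‖snap h z‖ ^ (-(s + 2)) by positivity)]
      have h7 : |inner ℝ (snap h z) (z - snap h z)| ≤ 1 * 1 :=
        (abs_real_inner_le_norm _ _).trans (mul_le_mul hT.le hdist (norm_nonneg _) zero_le_one)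
      calc s * ‖snap h z‖ ^ (-(s + 2)) * |inner ℝ (snap h z) (z - snap h z)|
          ≤ s * 2 ^ (s + 2) * (1 * 1) := by gcongr
        _ = _ := by ring
    refine (abs_add_le _ _).trans ?_
    rw [abs_of_nonneg (show 0 ≤ ‖snap h z‖ ^ (-s) by positivity)]
    linarith [p1 z, p2 z]

/-! ### Polynomial functions -/

theorem polyEval_add (p q : MvPolynomial (Fin d) ℝ) (z : Space d) :
    polyEval (p + q) z = polyEval p z + polyEval q z := map_add _ _ _

theorem polyEval_sub (p q : MvPolynomial (Fin d) ℝ) (z : Space d) :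
    polyEval (p - q) z = polyEval p z - polyEval q z := map_sub _ _ _

theorem polyEval_mul (p q : MvPolynomial (Fin d) ℝ) (z : Space d) :
    polyEval (p * q) z = polyEval p z * polyEval q z := map_mul _ _ _

theorem polyEval_smul (c : ℝ) (q : MvPolynomial (Fin d) ℝ) (z : Space d) :
    polyEval (c • q) z = c * polyEval q z := MvPolynomial.smul_eval _ _ _

theorem polyEval_sum {ι : Type*} (t : Finset ι) (p : ι → MvPolynomial (Fin d) ℝ) (z : Space d) :
    polyEval (∑ i ∈ t, p i) z = ∑ i ∈ t, polyEval (p i) z := map_sum _ _ _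

theorem polyEval_one (z : Space d) : polyEval 1 z = 1 := map_one _

theorem polyEval_C (c : ℝ) (z : Space d) : polyEval (MvPolynomial.C c) z = c :=
  MvPolynomial.eval_C _

theorem polyEval_X (i : Fin d) (z : Space d) : polyEval (MvPolynomial.X i) z = z i :=
  MvPolynomial.eval_X _

theorem contDiff_polyEval (p : MvPolynomial (Fin d) ℝ) : ContDiff ℝ 1 (polyEval p) := by
  induction p using MvPolynomial.induction_on with
  | C c =>
    rw [funext (polyEval_C c)]
    exact contDiff_const
  | add p q hp hq =>
    rw [funext (polyEval_add p q)]
    exact hp.add hq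
  | mul_X p i hp =>
    have : ContDiff ℝ 1 (fun z : Space d => z i) := by fun_prop
    rw [funext (polyEval_mul p _), funext (polyEval_X i)]
    exact hp.mul this

theorem continuous_polyEval (p : MvPolynomial (Fin d) ℝ) : Continuous (polyEval p) :=
  (contDiff_polyEval p).continuous

theorem exists_polyEval_lipschitz (p : MvPolynomial (Fin d) ℝ) (r : ℝ) :
    ∃ G : ℝ, 0 ≤ G ∧ ∀ y ∈ ball (0 : Space d) r, ∀ z ∈ ball (0 : Space d) r,
      |polyEval p y - polyEval p z| ≤ G * ‖y - z‖ := by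
  obtain ⟨G, hG⟩ := (isCompact_closedBall (0 : Space d) r).exists_bound_of_continuousOn
    ((contDiff_polyEval p).continuous_fderiv one_ne_zero).continuousOn
  refine ⟨|G|, abs_nonneg _, fun y hy z hz => ?_⟩
  exact (convex_closedBall (0 : Space d) r).norm_image_sub_le_of_norm_fderiv_le
    (fun x _ => (contDiff_polyEval p).differentiable one_ne_zero x)
    (fun x hx => (hG x hx).trans (le_abs_self G)) (ball_subset_closedBall hz)
    (ball_subset_closedBall hy)

theorem exists_polyEval_bound (p : MvPolynomial (Fin d) ℝ) (r : ℝ) :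
    ∃ M : ℝ, 0 ≤ M ∧ ∀ z ∈ closedBall (0 : Space d) r, |polyEval p z| ≤ M := by
  obtain ⟨M, hM⟩ := (isCompact_closedBall (0 : Space d) r).exists_bound_of_continuousOn
    (continuous_polyEval p).continuousOn
  exact ⟨|M|, abs_nonneg _, fun z hz => (hM z hz).trans (le_abs_self M)⟩

theorem eq_zero_of_polyEval_eq_zero {p : MvPolynomial (Fin d) ℝ}
    (hp : ∀ z ∈ ball (0 : Space d) 1, polyEval p z = 0) : p = 0 := by
  -- The box `(0, ε)^d` lies in the unit ball because `d ε < 1`, and a polynomial vanishing on a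
  -- product of infinite sets is zero.
  set ε : ℝ := 1 / (d + 1)
  have hε : 0 < ε := by positivity
  refine MvPolynomial.funext_set (fun _ => Set.Ioo 0 ε) (fun _ => Set.Ioo_infinite hε)
    fun x hx => ?_
  rw [map_zero]
  refine hp (WithLp.toLp 2 x) ?_
  rw [mem_ball_zero_iff]
  refine (norm_le_of_abs_le (c := ε) fun i => ?_).trans_lt ?_
  · have := hx i (Set.mem_univ i)
    exact (abs_of_pos this.1).le.trans this.2.le
  · rw [mul_one_div, div_lt_one (by positivity)]
    linarith

theorem integrableOn_continuous_mul_norm_rpow {s : ℝ} (hs0 : 0 ≤ s) (hsd : s < d)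
    {g : Space d → ℝ} (hg : Continuous g) (r : ℝ) :
    IntegrableOn (fun z => g z * ‖z‖ ^ (-s)) (ball (0 : Space d) r) := by
  have hd : 0 < d := by exact_mod_cast hs0.trans_lt hsd
  obtain ⟨M, hM⟩ := (isCompact_closedBall (0 : Space d) r).exists_bound_of_continuousOn
    hg.continuousOn
  refine (integrableOn_norm_rpow_ball hd hsd r).bdd_mul (c := M) hg.aestronglyMeasurable ?_
  exact (ae_restrict_iff' measurableSet_ball).2
    (Eventually.of_forall fun z hz => hM z (ball_subset_closedBall hz))

theorem integral_sq_pos {s : ℝ} (hs0 : 0 ≤ s) (hsd : s < d) {p : MvPolynomial (Fin d) ℝ}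
    (hp : p ≠ 0) : 0 < ∫ z in ball (0 : Space d) 1, polyEval (p * p) z * ‖z‖ ^ (-s) := by
  have hd : 0 < d := by exact_mod_cast hs0.trans_lt hsd
  have := nontrivial_space hd
  have hnn : ∀ z : Space d, 0 ≤ polyEval (p * p) z * ‖z‖ ^ (-s) := fun z => by
    rw [polyEval_mul]; exact mul_nonneg (mul_self_nonneg _) (by positivity)
  refine lt_of_le_of_ne (integral_nonneg hnn) fun h0 => hp (eq_zero_of_polyEval_eq_zero ?_)
  rw [eq_comm, setIntegral_eq_zero_iff_of_nonneg_ae (Eventually.of_forall hnn)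
    (integrableOn_continuous_mul_norm_rpow hs0 hsd (continuous_polyEval _) 1)] at h0
  have h1 : polyEval p =ᵐ[volume.restrict (ball 0 1)] fun _ => (0 : ℝ) := by
    have h2 : ∀ᵐ z : Space d ∂volume.restrict (ball 0 1), z ≠ 0 :=
      ae_restrict_of_ae (Measure.ae_ne volume 0)
    filter_upwards [h0, h2] with z hz hz0
    have h3 : 0 < ‖z‖ ^ (-s) := Real.rpow_pos_of_pos (norm_pos_iff.2 hz0) _
    simpa [polyEval_mul, h3.ne'] using hz
  exact Measure.eqOn_open_of_ae_eq h1 isOpen_ball (continuous_polyEval p).continuousOn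
    continuousOn_const

/-! ### Lattice moments -/

/-- The lattice approximation `h^d ∑ p(y) |y|^{-s}` of a moment of the unit ball. -/
def latticeMoment (s h : ℝ) (p : MvPolynomial (Fin d) ℝ) : ℝ :=
  h ^ d * ∑ᶠ y ∈ nbrs (lattice d h) 1 0, polyEval p y * ‖y‖ ^ (-s)

/-- The moment `∫_{B_1} p(z) |z|^{-s} dz`. -/
def ballMoment (s : ℝ) (p : MvPolynomial (Fin d) ℝ) : ℝ :=
  ∫ z in ball (0 : Space d) 1, polyEval p z * ‖z‖ ^ (-s)

theorem latticeMoment_sum_smul {s h : ℝ} (hh : 0 < h) {ι : Type*} (t : Finset ι) (c : ι → ℝ)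
    (p : ι → MvPolynomial (Fin d) ℝ) :
    latticeMoment s h (∑ i ∈ t, c i • p i) = ∑ i ∈ t, c i * latticeMoment s h (p i) := by
  have hfin := nbrs_finite hh (X := lattice d h) subset_rfl 1 (0 : Space d)
  simp only [latticeMoment, finsum_mem_eq_finite_toFinset_sum _ hfin, polyEval_sum, polyEval_smul,
    Finset.sum_mul, Finset.mul_sum]
  rw [Finset.sum_comm]
  refine Finset.sum_congr rfl fun i _ => Finset.sum_congr rfl fun y _ => by ring

theorem ballMoment_sum_smul {s : ℝ} (hs0 : 0 ≤ s) (hsd : s < d) {ι : Type*} (t : Finset ι)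
    (c : ι → ℝ) (p : ι → MvPolynomial (Fin d) ℝ) :
    ballMoment s (∑ i ∈ t, c i • p i) = ∑ i ∈ t, c i * ballMoment s (p i) := by
  simp only [ballMoment, polyEval_sum, polyEval_smul, Finset.sum_mul]
  rw [integral_finsetSum _ fun i _ => ?_]
  · refine Finset.sum_congr rfl fun i _ => ?_
    rw [← integral_const_mul]
    simp only [mul_assoc]
  · simp only [mul_assoc]
    exact (integrableOn_continuous_mul_norm_rpow hs0 hsd (continuous_polyEval _) 1).const_mul _

/-- Splitting `p` as `(p - p(0)) + p(0)` leaves a Lipschitz part vanishing at the origin, with error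
`O(h)`, and a multiple of the pure singular sum. -/
theorem latticeMoment_isBigO {s : ℝ} (hs0 : 0 ≤ s) (hsd : s < d) (p : MvPolynomial (Fin d) ℝ) :
    (fun h => latticeMoment s h p - ballMoment s p) =O[𝓝[>] 0]
      fun h : ℝ => h ^ min 1 ((d : ℝ) - s) := by
  have hd : 0 < d := by exact_mod_cast hs0.trans_lt hsd
  obtain ⟨C1, a1, hC1, ha1, H1⟩ := riemann_lipschitz hd hs0 hsd one_pos
  obtain ⟨C2, a2, hC2, ha2, H2⟩ := riemann_norm_rpow hs0 hsd
  obtain ⟨G, hG0, hG⟩ := exists_polyEval_lipschitz p 1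
  refine IsBigO.of_bound (C1 * G + |polyEval p 0| * C2) ?_
  have hmem : Set.Ioo (0 : ℝ) (min 1 (min a1 a2)) ∈ 𝓝[>] (0 : ℝ) :=
    Ioo_mem_nhdsGT (by positivity)
  filter_upwards [hmem] with h hh
  have hh1 : h < 1 := hh.2.trans_le (min_le_left _ _)
  have hha1 : h < a1 := hh.2.trans_le ((min_le_right _ _).trans (min_le_left _ _))
  have hha2 : h < a2 := hh.2.trans_le ((min_le_right _ _).trans (min_le_right _ _))
  have h1 := H1 h hh.1 hha1 G hG0 (fun z => polyEval p z - polyEval p 0) (sub_self _)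
    (fun y hy z hz => by simpa using hG y hy z hz)
  have h2 := H2 h hh.1 hha2
  have e1 : latticeMoment s h p =
      h ^ d * (∑ᶠ y ∈ nbrs (lattice d h) 1 0, (polyEval p y - polyEval p 0) * ‖y‖ ^ (-s)) +
      polyEval p 0 * (h ^ d * (∑ᶠ y ∈ nbrs (lattice d h) 1 0, ‖y‖ ^ (-s))) := by
    have hfin := nbrs_finite hh.1 (X := lattice d h) subset_rfl 1 (0 : Space d)
    simp only [latticeMoment, finsum_mem_eq_finite_toFinset_sum _ hfin, Finset.mul_sum]
    rw [← Finset.sum_add_distrib]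
    exact Finset.sum_congr rfl fun y _ => by ring
  have e2 : ballMoment s p =
      (∫ z in ball (0 : Space d) 1, (polyEval p z - polyEval p 0) * ‖z‖ ^ (-s)) +
      polyEval p 0 * ∫ z in ball (0 : Space d) 1, ‖z‖ ^ (-s) := by
    rw [← integral_const_mul, ← integral_add]
    · exact integral_congr_ae (Eventually.of_forall fun z => by ring)
    · exact integrableOn_continuous_mul_norm_rpow hs0 hsd
        ((continuous_polyEval p).sub continuous_const) 1
    · exact (integrableOn_norm_rpow_ball hd hsd 1).const_mul _
  have hha : h ≤ h ^ min 1 ((d : ℝ) - s) := by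
    simpa using Real.rpow_le_rpow_of_exponent_ge hh.1 hh1.le (min_le_left 1 ((d : ℝ) - s))
  have hh0 : 0 ≤ h ^ min 1 ((d : ℝ) - s) := Real.rpow_nonneg hh.1.le _
  rw [Real.norm_eq_abs, Real.norm_of_nonneg hh0, e1, e2, add_sub_add_comm, ← mul_sub]
  refine (abs_add_le _ _).trans ?_
  rw [abs_mul, add_mul, mul_assoc |polyEval p 0|]
  gcongr
  exact h1.trans (by gcongr)

/-! ### The moment matrix and the polynomial that reproduces moments -/

theorem tendsto_matrix_inv {n : Type*} [Fintype n] [DecidableEq n] {G : ℝ → Matrix n n ℝ}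
    {G₀ : Matrix n n ℝ} {l : Filter ℝ} (hG : Tendsto G l (𝓝 G₀)) (hdet : G₀.det ≠ 0) :
    Tendsto (fun h => (G h)⁻¹) l (𝓝 G₀⁻¹) := by
  have h1 : Tendsto (fun h => (G h).det) l (𝓝 G₀.det) :=
    ((continuous_id.matrix_det).tendsto G₀).comp hG
  have h2 : Tendsto (fun h => (G h).adjugate) l (𝓝 G₀.adjugate) :=
    ((continuous_id.matrix_adjugate).tendsto G₀).comp hG
  simp only [Matrix.inv_def, Ring.inverse_eq_inv']
  exact (h1.inv₀ hdet).smul h2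

/-- In a basis of the polynomials of degree at most three, the moment conditions on `q` read `G(h) c
= G₀ c₀`, where `c₀` are the coordinates of the constant `1`. Since `G(h) → G₀` at rate `h^α` and
`G₀` is invertible, `c` exists for small `h` and differs from `c₀` by `O(h^α)`. Invertibility of
`G(h)` also gives unisolvency. -/
theorem eventually_reproducing_polynomial {s : ℝ} (hs0 : 0 ≤ s) (hsd : s < d) :
    ∃ C h₁ : ℝ, 0 ≤ C ∧ 0 < h₁ ∧ ∀ h : ℝ, 0 < h → h < h₁ →
      Unisolvent 1 (lattice d h) 0 ∧
      ∃ q : MvPolynomial (Fin d) ℝ, q.totalDegree ≤ 3 ∧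
        (∀ p : MvPolynomial (Fin d) ℝ, p.totalDegree ≤ 3 →
          latticeMoment s h (p * q) = ballMoment s p) ∧
        ∀ z ∈ ball (0 : Space d) 1, |polyEval q z - 1| ≤ C * h ^ min 1 ((d : ℝ) - s) := by
  classical
  set α := min 1 ((d : ℝ) - s) with hα
  have hα0 : 0 < α := lt_min one_pos (by linarith)
  let V := MvPolynomial.restrictTotalDegree (Fin d) ℝ 3
  let b := Module.finBasis ℝ V
  set n := Module.finrank ℝ V
  let e : Fin n → MvPolynomial (Fin d) ℝ := fun i => (b i : MvPolynomial (Fin d) ℝ)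
  have he : ∀ i, (e i).totalDegree ≤ 3 := fun i =>
    (MvPolynomial.mem_restrictTotalDegree _ _ _).1 (b i).2
  have hcomb : ∀ c : Fin n → ℝ, (∑ i, c i • e i).totalDegree ≤ 3 := by
    intro c
    rw [← MvPolynomial.mem_restrictTotalDegree]
    exact Submodule.sum_mem _ fun i _ => Submodule.smul_mem _ _ (b i).2
  have hcoord : ∀ p : MvPolynomial (Fin d) ℝ, p.totalDegree ≤ 3 →
      ∃ c : Fin n → ℝ, p = ∑ i, c i • e i := by
    intro p hp
    let P : V := ⟨p, (MvPolynomial.mem_restrictTotalDegree _ _ _).2 hp⟩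
    refine ⟨b.repr P, ?_⟩
    have := congrArg V.subtype (b.sum_repr P)
    rw [map_sum] at this
    exact this.symm
  have hindep : ∀ c : Fin n → ℝ, ∑ i, c i • e i = 0 → c = 0 := by
    intro c hc
    have h1 : ∑ i, c i • b i = 0 := Subtype.ext (by simpa [e] using hc)
    exact funext fun i => Fintype.linearIndependent_iff.1 b.linearIndependent c h1 i
  let G : ℝ → Matrix (Fin n) (Fin n) ℝ := fun h => Matrix.of fun i j =>
    latticeMoment s h (e i * e j)
  let G₀ : Matrix (Fin n) (Fin n) ℝ := Matrix.of fun i j => ballMoment s (e i * e j)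
  have hmulG : ∀ h : ℝ, 0 < h → ∀ (c : Fin n → ℝ) (i : Fin n),
      (G h).mulVec c i = latticeMoment s h (e i * ∑ j, c j • e j) := by
    intro h hh c i
    simp only [Finset.mul_sum, mul_smul_comm, latticeMoment_sum_smul hh, Matrix.mulVec, dotProduct,
      G, Matrix.of_apply]
    exact Finset.sum_congr rfl fun j _ => mul_comm _ _
  have hmulG₀ : ∀ (c : Fin n → ℝ) (i : Fin n),
      G₀.mulVec c i = ballMoment s (e i * ∑ j, c j • e j) := by
    intro c i
    simp only [Finset.mul_sum, mul_smul_comm, ballMoment_sum_smul hs0 hsd, Matrix.mulVec,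
      dotProduct, G₀, Matrix.of_apply]
    exact Finset.sum_congr rfl fun j _ => mul_comm _ _
  -- A kernel vector of `G₀` would be the coordinates of a nonzero `p` with `∫ p² |z|^{-s} = 0`.
  have hdet : G₀.det ≠ 0 := by
    intro h0
    obtain ⟨c, hc, hGc⟩ := Matrix.exists_mulVec_eq_zero_iff.2 h0
    have hp : ∑ j, c j • e j ≠ 0 := fun h => hc (hindep c h)
    have h1 := integral_sq_pos hs0 hsd hp
    change 0 < ballMoment s _ at h1
    nth_rewrite 1 [Finset.sum_mul] at h1
    simp only [smul_mul_assoc] at h1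
    rw [ballMoment_sum_smul hs0 hsd] at h1
    simp [← hmulG₀, hGc] at h1
  have hrate : Tendsto (fun h : ℝ => h ^ α) (𝓝[>] 0) (𝓝 0) := by
    have := (Real.continuousAt_rpow_const 0 α (Or.inr hα0.le)).tendsto
    rw [Real.zero_rpow hα0.ne'] at this
    exact this.mono_left nhdsWithin_le_nhds
  have hGO : ∀ i j, (fun h => G h i j - G₀ i j) =O[𝓝[>] 0] fun h : ℝ => h ^ α :=
    fun i j => latticeMoment_isBigO hs0 hsd (e i * e j)
  have hGt : Tendsto G (𝓝[>] 0) (𝓝 G₀) := by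
    refine tendsto_pi_nhds.2 fun i => tendsto_pi_nhds.2 fun j => ?_
    have := ((hGO i j).trans_tendsto hrate).add_const (G₀ i j)
    simpa using this
  have hinv := tendsto_matrix_inv hGt hdet
  have hinvO : ∀ i j, (fun h => (G h)⁻¹ i j) =O[𝓝[>] 0] fun _ => (1 : ℝ) := fun i j =>
    (tendsto_pi_nhds.1 (tendsto_pi_nhds.1 hinv i) j).isBigO_one ℝ
  obtain ⟨c₀, hc₀⟩ := hcoord 1 (by simp)
  let c : ℝ → Fin n → ℝ := fun h => (G h)⁻¹.mulVec (G₀.mulVec c₀)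
  have hdetev : ∀ᶠ h in 𝓝[>] (0 : ℝ), (G h).det ≠ 0 :=
    (((continuous_id.matrix_det).tendsto G₀).comp hGt).eventually_ne hdet
  have hc : ∀ h, (G h).det ≠ 0 → ∀ i, c h i - c₀ i =
      -∑ j, (G h)⁻¹ i j * ∑ k, (G h j k - G₀ j k) * c₀ k := by
    intro h hne i
    have h1 : (G h)⁻¹.mulVec ((G h).mulVec c₀) = c₀ := by
      rw [Matrix.mulVec_mulVec, Matrix.nonsing_inv_mul _ (isUnit_iff_ne_zero.2 hne),
        Matrix.one_mulVec]
    have h2 : c h - c₀ = -(G h)⁻¹.mulVec ((G h - G₀).mulVec c₀) := by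
      rw [Matrix.sub_mulVec, Matrix.mulVec_sub, h1, neg_sub]
    exact congrFun h2 i
  have hcO : ∀ i, (fun h => c h i - c₀ i) =O[𝓝[>] 0] fun h : ℝ => h ^ α := by
    intro i
    have h1 : (fun h => -∑ j, (G h)⁻¹ i j * ∑ k, (G h j k - G₀ j k) * c₀ k) =O[𝓝[>] 0]
        fun h : ℝ => h ^ α := by
      refine IsBigO.neg_left (IsBigO.fun_sum fun j _ => ?_)
      have h2 : (fun h => ∑ k, (G h j k - G₀ j k) * c₀ k) =O[𝓝[>] 0] fun h : ℝ => h ^ α :=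
        IsBigO.fun_sum fun k _ => by
          simpa [mul_comm] using (hGO j k).const_mul_left (c₀ k)
      simpa using (hinvO i j).mul h2
    refine h1.congr' ?_ EventuallyEq.rfl
    filter_upwards [hdetev] with h hne
    exact (hc h hne i).symm
  choose M hM0 hM using fun i => exists_polyEval_bound (e i) 1
  have hsum : (fun h => ∑ i, |c h i - c₀ i| * M i) =O[𝓝[>] 0] fun h : ℝ => h ^ α :=
    IsBigO.fun_sum fun i _ => by
      simpa [mul_comm] using (hcO i).abs_left.const_mul_left (M i)
  obtain ⟨C, hC0, hC⟩ := hsum.exists_nonneg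
  have hev := (hC.bound.and hdetev)
  obtain ⟨h₁, hh₁, hsub⟩ := mem_nhdsGT_iff_exists_Ioo_subset.1 hev
  refine ⟨C, h₁, hC0, hh₁, fun h hh hhh₁ => ?_⟩
  obtain ⟨hb, hne⟩ := hsub ⟨hh, hhh₁⟩
  refine ⟨fun p hp hvan => ?_, ∑ i, c h i • e i, hcomb _, fun p hp => ?_, fun z hz => ?_⟩
  -- A polynomial vanishing at all neighbours has zero lattice moment against every basis element,
  -- so its coordinates lie in the kernel of `G h`.
  · obtain ⟨a, rfl⟩ := hcoord p hp
    have h1 : (G h).mulVec a = 0 := by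
      ext i
      rw [hmulG h hh, latticeMoment, finsum_mem_congr rfl (g := fun _ => (0 : ℝ))]
      · simp
      · intro y hy
        have := hvan y hy
        rw [sub_zero] at this
        rw [polyEval_mul, this, mul_zero, zero_mul]
    have h2 : a = 0 := by
      by_contra ha
      exact hne (Matrix.exists_mulVec_eq_zero_iff.1 ⟨a, ha, h1⟩)
    simp [h2]
  · obtain ⟨a, rfl⟩ := hcoord p hp
    rw [Finset.sum_mul]
    simp only [smul_mul_assoc]
    rw [latticeMoment_sum_smul hh, ballMoment_sum_smul hs0 hsd]
    refine Finset.sum_congr rfl fun i _ => ?_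
    rw [← hmulG h hh]
    have h1 : (G h).mulVec (c h) = G₀.mulVec c₀ := by
      rw [Matrix.mulVec_mulVec, Matrix.mul_nonsing_inv _ (isUnit_iff_ne_zero.2 hne),
        Matrix.one_mulVec]
    rw [h1, hmulG₀, ← hc₀, mul_one]
  · have h1 : polyEval (∑ i, c h i • e i) z - 1 = ∑ i, (c h i - c₀ i) * polyEval (e i) z := by
      have : (1 : ℝ) = polyEval (∑ i, c₀ i • e i) z := by rw [← hc₀, polyEval_one]
      rw [this, ← polyEval_sub, ← Finset.sum_sub_distrib, polyEval_sum]
      exact Finset.sum_congr rfl fun i _ => by rw [← sub_smul, polyEval_smul]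
    rw [h1]
    rw [Real.norm_of_nonneg (Finset.sum_nonneg fun i _ => mul_nonneg (abs_nonneg _) (hM0 i)),
      Real.norm_of_nonneg (Real.rpow_nonneg hh.le _)] at hb
    refine (Finset.abs_sum_le_sum_abs _ _).trans (le_trans (Finset.sum_le_sum fun i _ => ?_) hb)
    rw [abs_mul]
    gcongr
    exact hM i z (ball_subset_closedBall hz)

/-! ### The kernel -/

theorem kernel_of_lt {s D₀ δ r : ℝ} (hr0 : 0 ≤ r) (hr : r < δ) :
    kernel d s D₀ δ r = D₀ / δ ^ ((d : ℝ) + 2 - s) * r ^ (-s) := by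
  rw [kernel, if_pos hr, Real.rpow_neg hr0, ← div_eq_mul_inv, div_div]

theorem kernel_pos {s D₀ δ r : ℝ} (hD : 0 < D₀) (hr0 : 0 < r) (hr : r < δ) :
    0 < kernel d s D₀ δ r := by
  have hδ : 0 < δ := hr0.trans hr
  rw [kernel_of_lt hr0.le hr]
  positivity

theorem kernel_norm_smul {s D₀ δ : ℝ} (hδ : 0 < δ) {z : Space d} (hz : ‖z‖ < 1) :
    kernel d s D₀ δ ‖δ • z‖ = D₀ / δ ^ ((d : ℝ) + 2) * ‖z‖ ^ (-s) := by
  have h1 : ‖δ • z‖ = δ * ‖z‖ := by rw [norm_smul, Real.norm_of_nonneg hδ.le]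
  rw [h1, kernel_of_lt (by positivity) (by nlinarith), Real.mul_rpow hδ.le (norm_nonneg z),
    ← mul_assoc, Real.rpow_sub hδ, Real.rpow_neg hδ.le]
  have : 0 < δ ^ s := by positivity
  congr 1
  field_simp

theorem KernelNormalized.pos {s D₀ : ℝ} (hs0 : 0 ≤ s) (hsd : s < d)
    (hD : KernelNormalized d s D₀) : 0 < D₀ := by
  have hd' : (0 : ℝ) < d := hs0.trans_lt hsd
  have h1 : ∫ z in ball (0 : Space d) 1, kernel d s D₀ 1 ‖z‖ * ‖z‖ ^ 2 =
      D₀ * ∫ z in ball (0 : Space d) 1, ‖z‖ ^ (-s) * ‖z‖ ^ 2 := by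
    rw [← integral_const_mul]
    refine setIntegral_congr_fun measurableSet_ball fun z hz => ?_
    have hz' : ‖z‖ < 1 := by simpa using hz
    simp only [kernel_of_lt (norm_nonneg z) hz', Real.one_rpow, div_one]
    ring
  rw [KernelNormalized, h1] at hD
  have h2 : 0 ≤ ∫ z in ball (0 : Space d) 1, ‖z‖ ^ (-s) * ‖z‖ ^ 2 :=
    integral_nonneg fun z => by positivity
  by_contra! hc
  have := mul_nonpos_of_nonpos_of_nonneg hc h2
  linarith

/-! ### Translation and dilation -/

theorem mem_nbrs_lattice {h δ : ℝ} {x : Space d} (hx : x ∈ lattice d h) {y : Space d} :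
    y ∈ nbrs (lattice d h) δ x ↔ y - x ∈ nbrs (lattice d h) δ 0 := by
  have h1 : y ∈ lattice d h ↔ y - x ∈ lattice d h := by
    obtain ⟨k, hk⟩ := hx
    constructor
    · rintro ⟨l, hl⟩
      exact ⟨fun i => l i - k i, fun i => by rw [PiLp.sub_apply, hl, hk]; push_cast; ring⟩
    · rintro ⟨l, hl⟩
      refine ⟨fun i => l i + k i, fun i => ?_⟩
      have := hl i
      rw [PiLp.sub_apply, hk] at this
      push_cast; linarith
  rw [mem_nbrs_zero, ← h1]
  simp [nbrs, and_assoc, sub_eq_zero, dist_eq_norm]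

theorem smul_mem_nbrs_lattice {h δ : ℝ} (hδ : 0 < δ) {z : Space d} :
    δ • z ∈ nbrs (lattice d h) δ 0 ↔ z ∈ nbrs (lattice d (h / δ)) 1 0 := by
  rw [mem_nbrs_zero, mem_nbrs_zero]
  refine and_congr ?_ (and_congr ?_ ?_)
  · refine exists_congr fun k => forall_congr' fun i => ?_
    rw [PiLp.smul_apply, smul_eq_mul, ← mul_div_assoc, eq_div_iff hδ.ne', mul_comm]
  · rw [norm_smul, Real.norm_of_nonneg hδ.le]
    constructor <;> intro h <;> nlinarith
  · simp [hδ.ne']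

theorem finsum_nbrs_translate {h δ : ℝ} {x : Space d} (hx : x ∈ lattice d h) (F : Space d → ℝ) :
    ∑ᶠ y ∈ nbrs (lattice d h) δ x, F (y - x) = ∑ᶠ z ∈ nbrs (lattice d h) δ 0, F z := by
  refine finsum_mem_eq_of_bijOn (fun y => y - x) ⟨fun y hy => (mem_nbrs_lattice hx).1 hy,
    fun y _ z _ h => sub_left_injective h, fun z hz => ⟨z + x, ?_, by simp⟩⟩ fun y _ => rfl
  rw [mem_nbrs_lattice hx]
  simpa using hz

theorem finsum_nbrs_dilate {h δ : ℝ} (hδ : 0 < δ) (F : Space d → ℝ) :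
    ∑ᶠ z ∈ nbrs (lattice d h) δ 0, F z =
      ∑ᶠ z ∈ nbrs (lattice d (h / δ)) 1 0, F (δ • z) := by
  refine (finsum_mem_eq_of_bijOn (fun z => δ • z)
    ⟨fun z hz => (smul_mem_nbrs_lattice hδ).2 hz, fun y _ z _ h => smul_right_injective _ hδ.ne' h,
      fun z hz => ⟨δ⁻¹ • z, ?_, by simp [smul_smul, hδ.ne']⟩⟩ fun y _ => rfl).symm
  rw [← smul_mem_nbrs_lattice hδ]
  simpa [smul_smul, hδ.ne'] using hz

theorem setIntegral_ball_translate (x : Space d) (δ : ℝ) (F : Space d → ℝ) :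
    ∫ y in ball x δ, F (y - x) = ∫ z in ball 0 δ, F z := by
  rw [← integral_indicator measurableSet_ball, ← integral_indicator measurableSet_ball,
    ← integral_sub_right_eq_self ((ball (0 : Space d) δ).indicator F) x]
  congr 1
  ext y
  by_cases hy : y ∈ ball x δ
  · rw [Set.indicator_of_mem hy, Set.indicator_of_mem]
    simpa [dist_eq_norm] using hy
  · rw [Set.indicator_of_notMem hy, Set.indicator_of_notMem]
    simpa [dist_eq_norm] using hy

theorem setIntegral_ball_dilate {δ : ℝ} (hδ : 0 < δ) (F : Space d → ℝ) :
    ∫ z in ball 0 δ, F z = δ ^ d * ∫ z in ball (0 : Space d) 1, F (δ • z) := by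
  rw [Measure.setIntegral_comp_smul_of_pos _ _ _ hδ, _root_.smul_ball hδ.ne', smul_zero,
    Real.norm_of_nonneg hδ.le, mul_one, finrank_euclideanSpace_fin, smul_eq_mul, ← mul_assoc,
    mul_inv_cancel₀ (by positivity), one_mul]

theorem exists_dilated_polynomial (c : ℝ) (p : MvPolynomial (Fin d) ℝ) :
    ∃ p' : MvPolynomial (Fin d) ℝ, p'.totalDegree ≤ p.totalDegree ∧
      ∀ z : Space d, polyEval p' z = polyEval p (c • z) := by
  refine ⟨∑ m ∈ p.support, MvPolynomial.monomial m (p.coeff m * ∏ i, c ^ m i), ?_, fun z => ?_⟩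
  · refine MvPolynomial.totalDegree_finsetSum_le fun m hm => ?_
    exact (MvPolynomial.totalDegree_monomial_le _ _).trans (MvPolynomial.le_totalDegree hm)
  · rw [polyEval_sum, polyEval, MvPolynomial.eval_eq']
    refine Finset.sum_congr rfl fun m _ => ?_
    rw [polyEval, MvPolynomial.eval_monomial, Finsupp.prod_fintype _ _ (by simp)]
    simp only [PiLp.smul_apply, smul_eq_mul, mul_pow, Finset.prod_mul_distrib]
    ring

/-! ### Optimal weights -/

/-- Pythagoras: for feasible `w`, the difference `w - q` is orthogonal to `q` in the inner product
weighted by the kernel, because this orthogonality is the constraint tested with `p = q`. Positivity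
of the kernel on the neighbours turns equality of costs into equality of weights. -/
theorem optimal_of_polynomial {s D₀ δ : ℝ} {X : Set (Space d)} {x : Space d}
    (hfin : (nbrs X δ x).Finite) (hker : ∀ y ∈ nbrs X δ x, 0 < kernel d s D₀ δ ‖y - x‖)
    {q : MvPolynomial (Fin d) ℝ} (hq : q.totalDegree ≤ 3)
    (hrep : Reproduces s D₀ δ X x fun y => polyEval q (y - x)) :
    IsOptimalWeights s D₀ δ X x (fun y => polyEval q (y - x)) ∧
      ∀ w, IsOptimalWeights s D₀ δ X x w → ∀ y ∈ nbrs X δ x, w y = polyEval q (y - x) := by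
  have key : ∀ w, Reproduces s D₀ δ X x w → weightCost s D₀ δ X x w =
      weightCost s D₀ δ X x (fun y => polyEval q (y - x)) +
      ∑ y ∈ hfin.toFinset, (w y - polyEval q (y - x)) ^ 2 * kernel d s D₀ δ ‖y - x‖ / 2 := by
    intro w hw
    have h1 := (hw q hq).trans (hrep q hq).symm
    simp only [weightCost]
    rw [finsum_mem_eq_finite_toFinset_sum _ hfin, finsum_mem_eq_finite_toFinset_sum _ hfin] at *
    rw [← sub_eq_zero, ← Finset.sum_sub_distrib] at h1
    rw [← Finset.sum_add_distrib, ← sub_eq_zero, ← Finset.sum_sub_distrib, ← h1]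
    exact Finset.sum_congr rfl fun y _ => by ring
  have hnn : ∀ w : Space d → ℝ, ∀ y ∈ hfin.toFinset,
      0 ≤ (w y - polyEval q (y - x)) ^ 2 * kernel d s D₀ δ ‖y - x‖ / 2 := by
    intro w y hy
    have := hker y (hfin.mem_toFinset.1 hy)
    positivity
  refine ⟨⟨hrep, fun w hw => ?_⟩, fun w hw y hy => ?_⟩
  · rw [key w hw]
    exact le_add_of_nonneg_right (Finset.sum_nonneg (hnn w))
  · have h1 := hw.2 _ hrep
    rw [key w hw.1] at h1
    have h2 := (Finset.sum_eq_zero_iff_of_nonneg (hnn w)).1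
      (le_antisymm (by linarith) (Finset.sum_nonneg (hnn w))) y (hfin.mem_toFinset.2 hy)
    have h3 := hker y hy
    have h4 : (w y - polyEval q (y - x)) ^ 2 = 0 := by
      rcases mul_eq_zero.1 ((div_eq_zero_iff.1 h2).resolve_right two_ne_zero) with h | h
      · exact h
      · exact absurd h h3.ne'
    exact sub_eq_zero.1 (pow_eq_zero_iff two_ne_zero |>.1 h4)

theorem kernel_pos_of_mem_nbrs {s D₀ δ : ℝ} (hD : 0 < D₀) {X : Set (Space d)} {x y : Space d}
    (hy : y ∈ nbrs X δ x) : 0 < kernel d s D₀ δ ‖y - x‖ := by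
  refine kernel_pos hD ?_ ?_
  · exact norm_pos_iff.2 (sub_ne_zero.2 hy.2)
  · simpa [dist_eq_norm] using hy.1.2

/-- Translation and dilation reduce the problem at `x` with horizon `δ` to the unit ball with mesh
size `h/δ`. Thus `C` and `h₁` depend on neither `δ` nor `x`. -/
theorem weights_on_fine_mesh {s D₀ : ℝ} (hs0 : 0 ≤ s) (hsd : s < d) (hD : 0 < D₀) :
    ∃ C h₁ : ℝ, 0 ≤ C ∧ 0 < h₁ ∧ ∀ δ h : ℝ, 0 < δ → 0 < h → h < h₁ * δ → ∀ x ∈ lattice d h,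
      Unisolvent δ (lattice d h) x ∧
      (∃ w, IsOptimalWeights s D₀ δ (lattice d h) x w) ∧
      ∀ w, IsOptimalWeights s D₀ δ (lattice d h) x w → ∀ y ∈ nbrs (lattice d h) δ x,
        |w y - h ^ d| ≤ h ^ d * (C * (h / δ) ^ min 1 ((d : ℝ) - s)) := by
  obtain ⟨C, h₁, hC, hh₁, H⟩ := eventually_reproducing_polynomial hs0 hsd
  refine ⟨C, h₁, hC, hh₁, fun δ h hδ hh hhδ x hx => ?_⟩
  obtain ⟨huni, q, hq3, hq, hq1⟩ := H (h / δ) (by positivity) ((div_lt_iff₀ hδ).2 hhδ)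
  have hnz : ∀ {y}, y ∈ nbrs (lattice d h) δ x →
      δ⁻¹ • (y - x) ∈ nbrs (lattice d (h / δ)) 1 0 := by
    intro y hy
    rw [← smul_mem_nbrs_lattice hδ]
    simpa [smul_smul, hδ.ne'] using (mem_nbrs_lattice hx).1 hy
  refine ⟨fun p hp hvan => ?_, ?_⟩
  · obtain ⟨p', hp', hpe⟩ := exists_dilated_polynomial δ p
    have h1 : p' = 0 := by
      refine huni p' (hp'.trans hp) fun z hz => ?_
      have hz2 : x + δ • z ∈ nbrs (lattice d h) δ x := by
        rw [mem_nbrs_lattice hx, add_sub_cancel_left]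
        exact (smul_mem_nbrs_lattice hδ).2 hz
      have := hvan _ hz2
      rwa [add_sub_cancel_left, ← hpe, ← sub_zero z] at this
    refine eq_zero_of_polyEval_eq_zero fun z _ => ?_
    have h2 := hpe (δ⁻¹ • z)
    rw [smul_smul, mul_inv_cancel₀ hδ.ne', one_smul, h1] at h2
    rw [← h2]
    exact map_zero _
  -- The factor `h^d` is `δ^d`, from dilating the integral, times `(h/δ)^d`, from the definition of
  -- `latticeMoment`.
  · obtain ⟨q', hq', hqe⟩ := exists_dilated_polynomial δ⁻¹ (h ^ d • q)
    have hq'3 : q'.totalDegree ≤ 3 :=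
      hq'.trans ((MvPolynomial.totalDegree_smul_le _ _).trans hq3)
    have hfin := nbrs_finite hh (X := lattice d h) subset_rfl δ x
    have hrep : Reproduces s D₀ δ (lattice d h) x fun y => polyEval q' (y - x) := by
      intro p hp
      obtain ⟨p', hp', hpe⟩ := exists_dilated_polynomial δ p
      have h1 := hq p' (hp'.trans hp)
      rw [latticeMoment, ballMoment] at h1
      rw [finsum_nbrs_translate hx
          (fun z => polyEval p z * kernel d s D₀ δ ‖z‖ * polyEval q' z),
        setIntegral_ball_translate x δ (fun z => polyEval p z * kernel d s D₀ δ ‖z‖),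
        finsum_nbrs_dilate hδ, setIntegral_ball_dilate hδ]
      have e1 : ∫ z in ball (0 : Space d) 1, polyEval p (δ • z) * kernel d s D₀ δ ‖δ • z‖ =
          D₀ / δ ^ ((d : ℝ) + 2) * ∫ z in ball (0 : Space d) 1, polyEval p' z * ‖z‖ ^ (-s) := by
        rw [← integral_const_mul]
        refine setIntegral_congr_fun measurableSet_ball fun z hz => ?_
        have hz' : ‖z‖ < 1 := by simpa using hz
        simp only [kernel_norm_smul hδ hz', hpe]
        ring
      have hfin' := nbrs_finite (div_pos hh hδ) (X := lattice d (h / δ)) subset_rfl 1 0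
      rw [e1, ← h1, finsum_mem_eq_finite_toFinset_sum _ hfin',
        finsum_mem_eq_finite_toFinset_sum _ hfin', Finset.mul_sum, Finset.mul_sum, Finset.mul_sum]
      refine Finset.sum_congr rfl fun z hz => ?_
      have hz' := (mem_nbrs_zero.1 (hfin'.mem_toFinset.1 hz)).2.1
      rw [kernel_norm_smul hδ hz', hqe, smul_smul, inv_mul_cancel₀ hδ.ne', one_smul, polyEval_smul,
        polyEval_mul, hpe, div_pow]
      field_simp
    obtain ⟨ho, hu⟩ := optimal_of_polynomial hfin
      (fun y hy => kernel_pos_of_mem_nbrs hD hy) hq'3 hrep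
    refine ⟨⟨_, ho⟩, fun w hw y hy => ?_⟩
    rw [hu w hw y hy, hqe, polyEval_smul, ← mul_sub_one, abs_mul, abs_of_pos (by positivity)]
    gcongr
    exact hq1 _ (by simpa using (mem_nbrs_zero.1 (hnz hy)).2.1)

theorem exists_isPosConst {s D₀ : ℝ} (hs0 : 0 ≤ s) (hsd : s < d) (hD : 0 < D₀) :
    ∃ c, IsPosConst d s D₀ c := by
  obtain ⟨C, h₁, hC, hh₁, H⟩ := weights_on_fine_mesh hs0 hsd hD
  set α := min 1 ((d : ℝ) - s) with hα
  have hα0 : 0 < α := lt_min one_pos (by linarith)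
  have hrate : Tendsto (fun h : ℝ => C * h ^ α) (𝓝[>] 0) (𝓝 0) := by
    have := ((Real.continuousAt_rpow_const 0 α (Or.inr hα0.le)).tendsto.const_mul C)
    rw [Real.zero_rpow hα0.ne', mul_zero] at this
    exact this.mono_left nhdsWithin_le_nhds
  obtain ⟨h₂, hh₂, hsub⟩ := mem_nhdsGT_iff_exists_Ioo_subset.1
    (hrate.eventually (gt_mem_nhds one_pos))
  refine ⟨min h₁ h₂, lt_min hh₁ hh₂, fun δ h hδ hh hhδ x hx => ?_⟩
  have hb1 : h < h₁ * δ := hhδ.trans_le (by gcongr; exact min_le_left _ _)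
  have hb2 : h / δ < h₂ := (div_lt_iff₀ hδ).2 (hhδ.trans_le (by gcongr; exact min_le_right _ _))
  obtain ⟨h1, h2, h3⟩ := H δ h hδ hh hb1 x hx
  refine ⟨h1, h2, fun w hw y hy => ?_⟩
  have h4 := h3 w hw y hy
  have h5 : C * (h / δ) ^ α < 1 := hsub ⟨by positivity, hb2⟩
  have h6 : 0 < h ^ d := by positivity
  have h7 : h ^ d * (C * (h / δ) ^ α) < h ^ d * 1 := by gcongr
  linarith [(abs_le.1 h4).1]

/-! ### Moments of reproducing weights -/

/-- The powers of `δ` cancel: `δ^d` from the volume and `δ²` from `p` against `δ^{-(d+2)}` from the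
kernel. Second moments are therefore independent of `δ`, which makes the stability bound uniform in
the horizon. -/
theorem setIntegral_kernel_of_homogeneous {s D₀ δ : ℝ} (hδ : 0 < δ) (x : Space d)
    {p : MvPolynomial (Fin d) ℝ} (hp : ∀ z : Space d, polyEval p (δ • z) = δ ^ 2 * polyEval p z) :
    ∫ y in ball x δ, polyEval p (y - x) * kernel d s D₀ δ ‖y - x‖ = D₀ * ballMoment s p := by
  rw [setIntegral_ball_translate x δ (fun z => polyEval p z * kernel d s D₀ δ ‖z‖),
    setIntegral_ball_dilate hδ, ballMoment, ← integral_const_mul, ← integral_const_mul]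
  refine setIntegral_congr_fun measurableSet_ball fun z hz => ?_
  have hz' : ‖z‖ < 1 := by simpa using hz
  have h2 : δ ^ ((d : ℝ) + 2) = δ ^ d * δ ^ 2 := by
    rw [Real.rpow_add hδ, Real.rpow_natCast]; norm_cast
  simp only [kernel_norm_smul hδ hz', hp, h2]
  field_simp

theorem setIntegral_coord_mul_kernel (s D₀ δ : ℝ) (x : Space d) (i : Fin d) :
    ∫ y in ball x δ, polyEval (MvPolynomial.X i) (y - x) * kernel d s D₀ δ ‖y - x‖ = 0 := by
  rw [setIntegral_ball_translate x δ
    (fun z => polyEval (MvPolynomial.X i) z * kernel d s D₀ δ ‖z‖),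
    ← integral_indicator measurableSet_ball]
  set F : Space d → ℝ := (ball (0 : Space d) δ).indicator
    fun z => polyEval (MvPolynomial.X i) z * kernel d s D₀ δ ‖z‖
  have h1 : ∀ z, F (-z) = -F z := by
    intro z
    by_cases hz : z ∈ ball (0 : Space d) δ
    · have hz' : -z ∈ ball (0 : Space d) δ := by simpa using hz
      simp only [F, Set.indicator_of_mem hz, Set.indicator_of_mem hz', polyEval_X, norm_neg,
        PiLp.neg_apply, neg_mul]
    · have hz' : -z ∉ ball (0 : Space d) δ := by simpa using hz
      simp only [F, Set.indicator_of_notMem hz, Set.indicator_of_notMem hz', neg_zero]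
  have h2 := integral_neg_eq_self F volume
  simp only [h1, integral_neg] at h2
  linarith

/-- The polynomial `|z|²`. -/
def normSqPoly (d : ℕ) : MvPolynomial (Fin d) ℝ := ∑ i, MvPolynomial.X i ^ 2

theorem polyEval_normSqPoly (z : Space d) : polyEval (normSqPoly d) z = ‖z‖ ^ 2 := by
  rw [normSqPoly, polyEval_sum, EuclideanSpace.real_norm_sq_eq]
  exact Finset.sum_congr rfl fun i _ => by rw [pow_two, pow_two, polyEval_mul, polyEval_X]

theorem totalDegree_normSqPoly : (normSqPoly d).totalDegree ≤ 3 := by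
  refine MvPolynomial.totalDegree_finsetSum_le fun i _ => ?_
  rw [MvPolynomial.totalDegree_X_pow]
  norm_num

theorem ballMoment_normSqPoly {s D₀ : ℝ} (hD : KernelNormalized d s D₀) :
    D₀ * ballMoment s (normSqPoly d) = d := by
  rw [← hD, ballMoment, ← integral_const_mul]
  refine setIntegral_congr_fun measurableSet_ball fun z hz => ?_
  have hz' : ‖z‖ < 1 := by simpa using hz
  simp only [kernel_of_lt (norm_nonneg z) hz', Real.one_rpow, div_one, polyEval_normSqPoly]
  ring

section moments

variable {s D₀ δ : ℝ} {X : Set (Space d)} {x : Space d} {w : Space d → ℝ}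

theorem Reproduces.sum_eq (hw : Reproduces s D₀ δ X x w) (hfin : (nbrs X δ x).Finite)
    {p : MvPolynomial (Fin d) ℝ} (hp : p.totalDegree ≤ 3) :
    ∑ y ∈ hfin.toFinset, polyEval p (y - x) * (kernel d s D₀ δ ‖y - x‖ * w y) =
      ∫ y in ball x δ, polyEval p (y - x) * kernel d s D₀ δ ‖y - x‖ := by
  rw [← hw p hp, finsum_mem_eq_finite_toFinset_sum _ hfin]
  exact Finset.sum_congr rfl fun y _ => (mul_assoc _ _ _).symm

theorem Reproduces.sum_coord (hw : Reproduces s D₀ δ X x w) (hfin : (nbrs X δ x).Finite)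
    (i : Fin d) :
    ∑ y ∈ hfin.toFinset, (y - x) i * (kernel d s D₀ δ ‖y - x‖ * w y) = 0 := by
  have := hw.sum_eq hfin (p := MvPolynomial.X i) (by rw [MvPolynomial.totalDegree_X]; norm_num)
  rw [setIntegral_coord_mul_kernel] at this
  simpa only [polyEval_X] using this

theorem Reproduces.sum_coord_sq (hw : Reproduces s D₀ δ X x w) (hfin : (nbrs X δ x).Finite)
    (hδ : 0 < δ) (i : Fin d) :
    ∑ y ∈ hfin.toFinset, (y - x) i ^ 2 * (kernel d s D₀ δ ‖y - x‖ * w y) =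
      D₀ * ballMoment s (MvPolynomial.X i * MvPolynomial.X i) := by
  have := hw.sum_eq hfin (p := MvPolynomial.X i * MvPolynomial.X i)
    (by rw [← sq, MvPolynomial.totalDegree_X_pow]; norm_num)
  rw [setIntegral_kernel_of_homogeneous hδ x fun z => by
    simp only [polyEval_mul, polyEval_X, PiLp.smul_apply, smul_eq_mul]; ring] at this
  simpa only [polyEval_mul, polyEval_X, sq] using this

theorem Reproduces.sum_norm_sq (hw : Reproduces s D₀ δ X x w) (hfin : (nbrs X δ x).Finite)
    (hδ : 0 < δ) (hD : KernelNormalized d s D₀) :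
    ∑ y ∈ hfin.toFinset, ‖y - x‖ ^ 2 * (kernel d s D₀ δ ‖y - x‖ * w y) = d := by
  have := hw.sum_eq hfin (p := normSqPoly d) totalDegree_normSqPoly
  rw [setIntegral_kernel_of_homogeneous hδ x fun z => by
    rw [polyEval_normSqPoly, polyEval_normSqPoly, norm_smul, mul_pow,
      Real.norm_of_nonneg hδ.le], ballMoment_normSqPoly hD] at this
  simpa only [polyEval_normSqPoly] using this

theorem Reproduces.sum_kernel (hw : Reproduces s D₀ δ X x w) (hfin : (nbrs X δ x).Finite) :
    ∑ y ∈ hfin.toFinset, kernel d s D₀ δ ‖y - x‖ * w y =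
      ∫ z in ball (0 : Space d) δ, kernel d s D₀ δ ‖z‖ := by
  have := hw.sum_eq hfin (p := 1) (by simp)
  simp only [polyEval_one, one_mul] at this
  rw [this, setIntegral_ball_translate x δ fun z => kernel d s D₀ δ ‖z‖]

end moments

/-! ### Geometry of the domain and of the grid -/

theorem region_eq (Ω : Set (Space d)) (δ : ℝ) : region Ω δ = Ω ∪ thickening δ (frontier Ω) := by
  rw [region, collar, Set.union_sdiff_self]

theorem isOpen_region {Ω : Set (Space d)} (hΩ : IsOpen Ω) (δ : ℝ) : IsOpen (region Ω δ) := by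
  rw [region_eq]
  exact hΩ.union isOpen_thickening

theorem region_mono (Ω : Set (Space d)) {δ δ' : ℝ} (h : δ ≤ δ') : region Ω δ ⊆ region Ω δ' := by
  rw [region_eq, region_eq]
  exact Set.union_subset_union_right _ (thickening_mono h _)

theorem isBounded_region {Ω : Set (Space d)} (hΩ : Bornology.IsBounded Ω) (δ : ℝ) :
    Bornology.IsBounded (region Ω δ) := by
  rw [region_eq]
  exact hΩ.union ((hΩ.closure.subset frontier_subset_closure).thickening)

/-- A segment from a point of `Ω` to a point outside `Ω` meets the frontier, so the endpoint is
within `δ` of it. Consequently quadrature at an interior grid point sees every lattice neighbour,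
and admissibility on the full lattice applies. -/
theorem ball_subset_region {Ω : Set (Space d)} {x : Space d} (hx : x ∈ Ω) (δ : ℝ) :
    ball x δ ⊆ region Ω δ := by
  intro y hy
  rw [region_eq]
  by_cases hyΩ : y ∈ Ω
  · exact Or.inl hyΩ
  refine Or.inr ?_
  have hseg : IsPreconnected (segment ℝ x y) := (convex_segment x y).isPreconnected
  obtain ⟨z, hz, hzf⟩ : ∃ z ∈ segment ℝ x y, z ∈ frontier Ω := by
    by_contra! hc
    have hsub : segment ℝ x y ⊆ interior Ω ∪ (closure Ω)ᶜ := by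
      intro z hz
      have := hc z hz
      rw [frontier, Set.mem_sdiff, not_and, not_not] at this
      by_cases hzc : z ∈ closure Ω
      · exact Or.inl (this hzc)
      · exact Or.inr hzc
    obtain ⟨z, _, hz1, hz2⟩ := hseg _ _ isOpen_interior isClosed_closure.isOpen_compl hsub
      ⟨x, left_mem_segment ℝ x y, (hsub (left_mem_segment ℝ x y)).resolve_right
        fun h => h (subset_closure hx)⟩
      ⟨y, right_mem_segment ℝ x y, (hsub (right_mem_segment ℝ x y)).resolve_left
        fun h => hyΩ (interior_subset h)⟩
    exact hz2 (subset_closure (interior_subset hz1))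
  rw [mem_thickening_iff]
  refine ⟨z, hzf, ?_⟩
  have h1 : dist x z + dist z y = dist x y := dist_add_dist_of_mem_segment hz
  have h2 : dist y x < δ := hy
  rw [dist_comm y z]
  rw [dist_comm y x] at h2
  linarith [dist_nonneg (x := x) (y := z)]

theorem grid_finite {Ω : Set (Space d)} (hΩ : Bornology.IsBounded Ω) (δ : ℝ) {h : ℝ}
    (hh : 0 < h) : (grid Ω δ h).Finite := by
  obtain ⟨ρ, hρ⟩ := (isBounded_region hΩ δ).subset_ball (0 : Space d)
  refine ((nbrs_finite hh (X := lattice d h) subset_rfl ρ 0).insert 0).subset fun y hy => ?_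
  by_cases h0 : y = 0
  · exact Or.inl h0
  · exact Or.inr ⟨⟨hy.1, hρ hy.2⟩, h0⟩

theorem nbrs_grid {Ω : Set (Space d)} {x : Space d} (hx : x ∈ Ω) (δ h : ℝ) :
    nbrs (grid Ω δ h) δ x = nbrs (lattice d h) δ x := by
  ext y
  simp only [nbrs, grid, Set.mem_sdiff, Set.mem_inter_iff]
  constructor
  · rintro ⟨⟨⟨h1, _⟩, h2⟩, h3⟩
    exact ⟨⟨h1, h2⟩, h3⟩
  · rintro ⟨⟨h1, h2⟩, h3⟩
    exact ⟨⟨⟨h1, ball_subset_region hx δ h2⟩, h2⟩, h3⟩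

theorem isOptimalWeights_grid {s D₀ δ h : ℝ} {Ω : Set (Space d)} {x : Space d} (hx : x ∈ Ω)
    {w : Space d → ℝ} : IsOptimalWeights s D₀ δ (grid Ω δ h) x w ↔
      IsOptimalWeights s D₀ δ (lattice d h) x w := by
  simp only [IsOptimalWeights, Reproduces, weightCost, nbrs_grid hx]

theorem C1BoundedBy.lipschitz {M : ℝ} {g : Space d → ℝ} {D : Set (Space d)}
    (hg : C1BoundedBy M g D) (hD : IsOpen D) {x : Space d} {δ : ℝ} (hx : ball x δ ⊆ D)
    {y z : Space d} (hy : y ∈ ball x δ) (hz : z ∈ ball x δ) : |g y - g z| ≤ M * ‖y - z‖ :=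
  (convex_ball x δ).norm_image_sub_le_of_norm_fderiv_le
    (fun _ ht => (hg.1.differentiableOn one_ne_zero).differentiableAt (hD.mem_nhds (hx ht)))
    (fun t ht => (hg.2 t (hx ht)).2) hz hy

/-! ### The discrete maximum principle -/

/-- At a maximum point in `Ω` every difference is nonpositive, which contradicts the strict
inequality. Strictness removes any need for connectedness of the grid. -/
theorem le_of_discrete_subsolution {T Ω : Set (Space d)} (hT : T.Finite)
    {N : Space d → Finset (Space d)} (hN : ∀ x ∈ T ∩ Ω, ∀ y ∈ N x, y ∈ T)
    {a : Space d → Space d → ℝ} (ha : ∀ x ∈ T ∩ Ω, ∀ y ∈ N x, 0 ≤ a x y) {w : Space d → ℝ}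
    (hw : ∀ x ∈ T ∩ Ω, 0 < ∑ y ∈ N x, a x y * (w y - w x)) {B : ℝ}
    (hB : ∀ x ∈ T, x ∉ Ω → w x ≤ B) : ∀ x ∈ T, w x ≤ B := by
  intro x hx
  obtain ⟨x₀, hx₀, hmax⟩ := Set.exists_max_image T w hT ⟨x, hx⟩
  refine (hmax x hx).trans (hB x₀ hx₀ fun hΩ => ?_)
  refine (hw x₀ ⟨hx₀, hΩ⟩).not_ge (Finset.sum_nonpos fun y hy => ?_)
  exact mul_nonpos_of_nonneg_of_nonpos (ha x₀ ⟨hx₀, hΩ⟩ y hy)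
    (sub_nonpos.2 (hmax y (hN x₀ ⟨hx₀, hΩ⟩ y hy)))

/-- Square `1 + τ/2 ≤ exp(τ/2)`, whose left side is nonnegative in this range. -/
theorem exp_sub_one_ge {τ : ℝ} (hτ : |τ| ≤ 1) : τ + τ ^ 2 / 4 ≤ Real.exp τ - 1 := by
  have h1 : τ / 2 + 1 ≤ Real.exp (τ / 2) := Real.add_one_le_exp _
  have h2 : Real.exp τ = Real.exp (τ / 2) ^ 2 := by
    rw [← Real.exp_nat_mul]; congr 1; push_cast; ring
  have h3 : 0 ≤ τ / 2 + 1 := by linarith [(abs_le.1 hτ).1]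
  rw [h2]
  nlinarith

section discrete

variable {s D₀ δ h : ℝ} {Ω : Set (Space d)} {A ω : Space d → Space d → ℝ}

theorem discreteOp_eq_sum (v : Space d → ℝ) (x : Space d)
    (hfin : (nbrs (grid Ω δ h) δ x).Finite) :
    discreteOp s D₀ δ h Ω A ω v x = 2 * ∑ y ∈ hfin.toFinset,
      A x y * (kernel d s D₀ δ ‖y - x‖ * ω x y) * (v y - v x) := by
  rw [discreteOp, finsum_mem_eq_finite_toFinset_sum _ hfin]
  congr 1
  exact Finset.sum_congr rfl fun y _ => by ring

theorem discreteOp_add_smul (hh : 0 < h) (v v' : Space d → ℝ) (c : ℝ) (x : Space d) :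
    discreteOp s D₀ δ h Ω A ω (fun y => v y + c * v' y) x =
      discreteOp s D₀ δ h Ω A ω v x + c * discreteOp s D₀ δ h Ω A ω v' x := by
  have hfin := nbrs_finite hh (X := grid Ω δ h) Set.inter_subset_left δ x
  simp only [discreteOp_eq_sum _ x hfin, Finset.mul_sum, ← Finset.sum_add_distrib]
  exact Finset.sum_congr rfl fun y _ => by ring

/-- Factor out `exp(λ x_i)` and use `exp(λt) - 1 ≥ λt + (λt)²/4` with `t = (y - x)_i`. The quadratic
term gives the gain through the exact second moment. In the linear term, `A(x,y)` is frozen to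
`A(x,x)`, whose contribution vanishes with the first moment; the freezing error is at most `λM|y -
x|²`, which sums to `λMd`. -/
theorem discreteOp_exp_ge (hδ : 0 < δ) (hh : 0 < h) (hD : KernelNormalized d s D₀)
    (hD0 : 0 < D₀) {x : Space d} (hw : Reproduces s D₀ δ (grid Ω δ h) x (ω x))
    (hpos : ∀ y ∈ nbrs (grid Ω δ h) δ x, 0 < ω x y)
    {r M : ℝ} (hr : 0 ≤ r)
    (hA : ∀ y ∈ ball x δ, r ≤ A x y) (hAL : ∀ y ∈ ball x δ, |A x y - A x x| ≤ M * ‖y - x‖)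
    {lam : ℝ} (hlam : 0 < lam) (hlamδ : lam * δ ≤ 1) (i : Fin d) :
    2 * (Real.exp (lam * x i) * (lam ^ 2 / 4 *
      (r * (D₀ * ballMoment s (MvPolynomial.X i * MvPolynomial.X i))) - lam * (M * d))) ≤
      discreteOp s D₀ δ h Ω A ω (fun y => Real.exp (lam * y i)) x := by
  have hfin := nbrs_finite hh (X := grid Ω δ h) Set.inter_subset_left δ x
  rw [discreteOp_eq_sum _ x hfin]
  set W : Space d → ℝ := fun y => kernel d s D₀ δ ‖y - x‖ * ω x y with hWdef
  have hmem : ∀ y ∈ hfin.toFinset, y ∈ ball x δ ∧ 0 < W y := by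
    intro y hy
    have hy' := hfin.mem_toFinset.1 hy
    exact ⟨hy'.1.2, mul_pos (kernel_pos_of_mem_nbrs hD0 hy') (hpos y hy')⟩
  have m1 := hw.sum_coord hfin i
  have m2 := hw.sum_coord_sq hfin hδ i
  have m3 := hw.sum_norm_sq hfin hδ hD
  rw [← m2, ← m3, Finset.mul_sum, Finset.mul_sum, Finset.mul_sum, Finset.mul_sum,
    ← Finset.sum_sub_distrib]
  have hzero : ∑ y ∈ hfin.toFinset, lam * A x x * ((y - x) i * W y) = 0 := by
    rw [← Finset.mul_sum, m1, mul_zero]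
  gcongr
  rw [← sub_nonneg, ← sub_nonneg, Finset.mul_sum, sub_zero, ← Finset.sum_sub_distrib]
  have hfac : ∀ y ∈ hfin.toFinset,
      Real.exp (lam * x i) * (lam * A x x * ((y - x) i * W y)) ≤
      A x y * (kernel d s D₀ δ ‖y - x‖ * ω x y) * (Real.exp (lam * y i) - Real.exp (lam * x i)) -
      Real.exp (lam * x i) * (lam ^ 2 / 4 * (r * ((y - x) i ^ 2 *
        (kernel d s D₀ δ ‖y - x‖ * ω x y))) - lam * (M * (‖y - x‖ ^ 2 *
        (kernel d s D₀ δ ‖y - x‖ * ω x y)))) := by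
    intro y hy
    obtain ⟨hyb, hWy⟩ := hmem y hy
    change _ ≤ A x y * W y * _ - Real.exp (lam * x i) * (lam ^ 2 / 4 * (r * (_ * W y)) -
      lam * (M * (_ * W y)))
    set t := (y - x) i with ht
    have htn : |t| ≤ ‖y - x‖ := abs_apply_le_norm _ i
    have hyδ : ‖y - x‖ < δ := by simpa [dist_eq_norm] using hyb
    have hexp : Real.exp (lam * y i) = Real.exp (lam * x i) * Real.exp (lam * t) := by
      rw [← Real.exp_add, ht, PiLp.sub_apply]; congr 1; ring
    have hτ : |lam * t| ≤ 1 := by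
      rw [abs_mul, abs_of_pos hlam]
      nlinarith
    have h1 := exp_sub_one_ge hτ
    have hAy := hA y hyb
    have hApos : 0 ≤ A x y := hr.trans hAy
    have h2 : A x y * (lam * t + (lam * t) ^ 2 / 4) ≤ A x y * (Real.exp (lam * t) - 1) := by gcongr
    have h3 : r * ((lam * t) ^ 2 / 4) ≤ A x y * ((lam * t) ^ 2 / 4) := by gcongr
    have h4 : -(M * ‖y - x‖ ^ 2) ≤ (A x y - A x x) * t := by
      have : |(A x y - A x x) * t| ≤ M * ‖y - x‖ ^ 2 := by
        rw [abs_mul]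
        calc |A x y - A x x| * |t| ≤ (M * ‖y - x‖) * ‖y - x‖ :=
              mul_le_mul (hAL y hyb) htn (abs_nonneg _) ((abs_nonneg _).trans (hAL y hyb))
          _ = _ := by ring
      exact (abs_le.1 this).1
    have h5 : lam * -(M * ‖y - x‖ ^ 2) ≤ lam * ((A x y - A x x) * t) := by gcongr
    have h6 : 0 ≤ A x y * (Real.exp (lam * t) - 1) - (lam ^ 2 / 4 * (r * t ^ 2) -
        lam * (M * ‖y - x‖ ^ 2)) - lam * A x x * t := by nlinarith
    have h7 := mul_nonneg (mul_nonneg (Real.exp_pos (lam * x i)).le hWy.le) h6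
    rw [hexp]
    nlinarith
  have := Finset.sum_le_sum hfac
  rw [← Finset.mul_sum, hzero, mul_zero] at this
  exact this

/-- Both `(ε/c)φ + v` and `(ε/c)φ - v` are strict subsolutions, so they are bounded by their values
off `Ω`, where `v = 0`. Since `φ ≥ 0`, this bounds `±v`. -/
theorem abs_le_of_barrier (hΩ : Bornology.IsBounded Ω) (hh : 0 < h)
    (hcoef : ∀ x ∈ grid Ω δ h ∩ Ω, ∀ y ∈ nbrs (grid Ω δ h) δ x,
      0 ≤ A x y * (kernel d s D₀ δ ‖y - x‖ * ω x y))
    {φ : Space d → ℝ} {c B : ℝ} (hc : 0 < c)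
    (hφ : ∀ x ∈ grid Ω δ h ∩ Ω, c < discreteOp s D₀ δ h Ω A ω φ x)
    (hφB : ∀ x ∈ grid Ω δ h, 0 ≤ φ x ∧ φ x ≤ B)
    {v : Space d → ℝ} {ε : ℝ} (hε : 0 < ε)
    (hv : ∀ x ∈ grid Ω δ h ∩ Ω, |discreteOp s D₀ δ h Ω A ω v x| ≤ ε)
    (hv0 : ∀ x ∈ grid Ω δ h, x ∉ Ω → v x = 0) :
    ∀ x ∈ grid Ω δ h, |v x| ≤ ε * (B / c) := by
  have hfin := fun x => nbrs_finite hh (X := grid Ω δ h) Set.inter_subset_left δ x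
  have key : ∀ σ : ℝ, |σ| = 1 → ∀ x ∈ grid Ω δ h, σ * v x ≤ ε * (B / c) := by
    intro σ hσ
    have hmain := le_of_discrete_subsolution (grid_finite hΩ δ hh) (Ω := Ω)
      (N := fun x => (hfin x).toFinset)
      (a := fun x y => A x y * (kernel d s D₀ δ ‖y - x‖ * ω x y))
      (w := fun y => ε / c * φ y + σ * v y) (B := ε * (B / c))
      (fun x _ y hy => ((hfin x).mem_toFinset.1 hy).1.1)
      (fun x hx y hy => hcoef x hx y ((hfin x).mem_toFinset.1 hy))
      (fun x hx => ?_) (fun x hx hxΩ => ?_)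
    · intro x hx
      have h1 := hmain x hx
      have h2 : 0 ≤ ε / c * φ x := mul_nonneg (by positivity) (hφB x hx).1
      linarith
    · have h1 := discreteOp_add_smul (s := s) (D₀ := D₀) (δ := δ) (Ω := Ω) (A := A) (ω := ω) hh
        (fun y => ε / c * φ y) v σ x
      have h2 := discreteOp_add_smul (s := s) (D₀ := D₀) (δ := δ) (Ω := Ω) (A := A) (ω := ω) hh
        (fun _ => 0) φ (ε / c) x
      simp only [zero_add] at h2
      have h0 : discreteOp s D₀ δ h Ω A ω (fun _ => 0) x = 0 := by simp [discreteOp]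
      rw [h2, h0, zero_add] at h1
      have h3 : |σ * discreteOp s D₀ δ h Ω A ω v x| ≤ ε := by
        rw [abs_mul, hσ, one_mul]; exact hv x hx
      have h4 : ε < ε / c * discreteOp s D₀ δ h Ω A ω φ x := by
        rw [div_mul_eq_mul_div, lt_div_iff₀ hc]
        exact mul_lt_mul_of_pos_left (hφ x hx) hε
      have h5 := (abs_le.1 h3).1
      rw [discreteOp_eq_sum (fun y => ε / c * φ y + σ * v y) x (hfin x)] at h1
      linarith
    · simp only [hv0 x hx hxΩ, mul_zero, add_zero]
      calc ε / c * φ x ≤ ε / c * B := by gcongr; exact (hφB x hx).2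
        _ = _ := by ring
  intro x hx
  rw [abs_le']
  have h1 := key 1 (by simp) x hx
  have h2 := key (-1) (by simp) x hx
  constructor <;> linarith

/-- Unique solvability of the discrete problem, with the error `e = u_h - u` prescribed by its
residual. -/
theorem exists_discrete_correction (hΩ : Bornology.IsBounded Ω) (hh : 0 < h)
    (hinj : ∀ v : Space d → ℝ, (∀ x ∈ grid Ω δ h ∩ Ω, discreteOp s D₀ δ h Ω A ω v x = 0) →
      (∀ x ∈ grid Ω δ h, x ∉ Ω → v x = 0) → ∀ x ∈ grid Ω δ h, v x = 0) (g : Space d → ℝ) :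
    ∃ v : Space d → ℝ, (∀ x ∈ grid Ω δ h ∩ Ω, discreteOp s D₀ δ h Ω A ω v x = g x) ∧
      ∀ x, x ∉ Ω → v x = 0 := by
  classical
  set T : Set (Space d) := grid Ω δ h ∩ Ω with hT
  have hTfin : T.Finite := (grid_finite hΩ δ hh).inter_of_left Ω
  have := hTfin.fintype
  let ext : (T → ℝ) → Space d → ℝ := fun v y => if hy : y ∈ T then v ⟨y, hy⟩ else 0
  have hext0 : ∀ v, ∀ x, x ∉ Ω → ext v x = 0 := fun v x hx => dif_neg fun h => hx h.2
  have hadd : ∀ (v v' : T → ℝ) (c : ℝ), ext (v + c • v') = fun y => ext v y + c * ext v' y := by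
    intro v v' c
    ext y
    by_cases hy : y ∈ T <;> simp [ext, hy]
  let Φ : (T → ℝ) →ₗ[ℝ] (T → ℝ) :=
    { toFun := fun v x => discreteOp s D₀ δ h Ω A ω (ext v) x
      map_add' := fun v v' => by
        ext x
        have := discreteOp_add_smul (s := s) (D₀ := D₀) (δ := δ) (Ω := Ω) (A := A) (ω := ω) hh
          (ext v) (ext v') 1 x
        rw [← hadd, one_smul, one_mul] at this
        exact this
      map_smul' := fun c v => by
        ext x
        have := discreteOp_add_smul (s := s) (D₀ := D₀) (δ := δ) (Ω := Ω) (A := A) (ω := ω) hh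
          (ext 0) (ext v) c x
        rw [← hadd, zero_add] at this
        have h0 : ext 0 = fun _ => 0 := by ext y; simp [ext]
        have h1 : discreteOp s D₀ δ h Ω A ω (fun _ => 0) (x : Space d) = 0 := by simp [discreteOp]
        rw [h0, h1, zero_add] at this
        exact this }
  have hΦ : Function.Injective Φ := by
    rw [← LinearMap.ker_eq_bot, LinearMap.ker_eq_bot']
    intro v hv
    ext x
    have h1 := hinj (ext v) (fun y hy => congrFun hv ⟨y, hy⟩) (fun y _ hy => hext0 v y hy) x x.2.1
    simpa [ext] using h1
  obtain ⟨v, hv⟩ := (LinearMap.injective_iff_surjective.1 hΦ) fun x => g x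
  exact ⟨ext v, fun x hx => congrFun hv ⟨x, hx⟩, hext0 v⟩

end discrete

/-! ### Consistency of the quadrature -/

/-- Two regimes. For small `h`, replacing the weights by `h^d` costs a relative `O(h^α)` and the
resulting Riemann sum costs `O(h)`. For `h` bounded below by `η`, nothing is asymptotic, but both
terms are bounded and `h^α ≥ η^α`, so a large constant suffices. -/
theorem quadrature_error_le {s D₀ c δ : ℝ} (hs0 : 0 ≤ s) (hsd : s < d)
    (hD : KernelNormalized d s D₀) (hc : IsPosConst d s D₀ c) (hδ : 0 < δ) {G : ℝ} (hG : 0 ≤ G) :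
    ∃ C : ℝ, 0 < C ∧ ∀ h : ℝ, 0 < h → h < c * δ → ∀ x ∈ lattice d h, ∀ w : Space d → ℝ,
      IsOptimalWeights s D₀ δ (lattice d h) x w → ∀ g : Space d → ℝ, g 0 = 0 →
      (∀ y ∈ ball (0 : Space d) δ, ∀ z ∈ ball (0 : Space d) δ, |g y - g z| ≤ G * ‖y - z‖) →
      |(∑ᶠ y ∈ nbrs (lattice d h) δ x, g (y - x) * (kernel d s D₀ δ ‖y - x‖ * w y)) -
        ∫ y in ball x δ, g (y - x) * kernel d s D₀ δ ‖y - x‖| ≤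
        C * h ^ min 1 ((d : ℝ) - s) := by
  have hd' : (0 : ℝ) < d := hs0.trans_lt hsd
  have hd : 0 < d := by exact_mod_cast hd'
  have hD0 : 0 < D₀ := hD.pos hs0 hsd
  set α := min 1 ((d : ℝ) - s) with hα
  have hα0 : 0 < α := lt_min one_pos (by linarith)
  obtain ⟨C1, a1, hC1, ha1, H1⟩ := riemann_lipschitz hd hs0 hsd hδ
  obtain ⟨C2, a2, hC2, ha2, H2⟩ := weights_on_fine_mesh hs0 hsd hD0
  set B := D₀ / δ ^ ((d : ℝ) + 2 - s) with hB
  have hB0 : 0 < B := by positivity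
  set J := ∫ z in ball (0 : Space d) δ, ‖z‖ * ‖z‖ ^ (-s) with hJ
  have hJ0 : 0 ≤ J := integral_nonneg fun z => by positivity
  set m := ∫ z in ball (0 : Space d) δ, kernel d s D₀ δ ‖z‖ with hm
  set η := min 1 (min a1 (a2 * δ)) with hη
  have hη0 : 0 < η := by positivity
  have hJint : IntegrableOn (fun z : Space d => ‖z‖ * ‖z‖ ^ (-s)) (ball 0 δ) :=
    integrableOn_continuous_mul_norm_rpow hs0 hsd continuous_norm δ
  -- `E` is the crude bound for the coarse regime: the sum through the zeroth and second moments of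
  -- the weights, plus the integral.
  set E := G * (|m| + d) + B * (G * J) with hE
  have hE0 : 0 ≤ E := by positivity
  refine ⟨E / η ^ α + B * C1 * G + G * B * C2 / δ ^ α * (J + C1) + 1, by positivity,
    fun h hh hhc x hx w hw g hg0 hg => ?_⟩
  have hh0 : 0 < h ^ α := by positivity
  have hgz : ∀ z : Space d, ‖z‖ < δ → |g z| ≤ G * ‖z‖ := by
    intro z hz
    simpa [hg0] using hg z (by simpa using hz) 0 (by simpa using hδ)
  have hfin := nbrs_finite hh (X := lattice d h) subset_rfl δ x
  have hmem : ∀ y ∈ hfin.toFinset, ‖y - x‖ < δ ∧ 0 < kernel d s D₀ δ ‖y - x‖ := by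
    intro y hy
    have hy' := hfin.mem_toFinset.1 hy
    exact ⟨by simpa [dist_eq_norm] using hy'.1.2, kernel_pos_of_mem_nbrs hD0 hy'⟩
  have hker : ∀ z : Space d, ‖z‖ < δ → kernel d s D₀ δ ‖z‖ = B * ‖z‖ ^ (-s) :=
    fun z hz => kernel_of_lt (norm_nonneg z) hz
  have hint : ∫ y in ball x δ, g (y - x) * kernel d s D₀ δ ‖y - x‖ =
      B * ∫ z in ball (0 : Space d) δ, g z * ‖z‖ ^ (-s) := by
    rw [setIntegral_ball_translate x δ fun z => g z * kernel d s D₀ δ ‖z‖, ← integral_const_mul]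
    refine setIntegral_congr_fun measurableSet_ball fun z hz => ?_
    simp only [hker z (by simpa using hz)]
    ring
  have hintb : |∫ z in ball (0 : Space d) δ, g z * ‖z‖ ^ (-s)| ≤ G * J := by
    rw [hJ, ← integral_const_mul, ← Real.norm_eq_abs]
    refine norm_integral_le_of_norm_le (hJint.const_mul G)
      ((ae_restrict_iff' measurableSet_ball).2 (Eventually.of_forall fun z hz => ?_))
    rw [norm_mul, Real.norm_eq_abs, Real.norm_of_nonneg (show 0 ≤ ‖z‖ ^ (-s) by positivity),
      ← mul_assoc]
    gcongr
    exact hgz z (by simpa using hz)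
  rw [hint, finsum_mem_eq_finite_toFinset_sum _ hfin]
  set t4 := G * B * C2 / δ ^ α * (J + C1) with ht4
  have ht40 : 0 ≤ t4 := by positivity
  rcases lt_or_ge h η with hsmall | hlarge
  · have hh1 : h < 1 := hsmall.trans_le (min_le_left _ _)
    have hha1 : h < a1 := hsmall.trans_le ((min_le_right _ _).trans (min_le_left _ _))
    have hha2 : h < a2 * δ := hsmall.trans_le ((min_le_right _ _).trans (min_le_right _ _))
    have hha : h ≤ h ^ α := by
      simpa using Real.rpow_le_rpow_of_exponent_ge hh hh1.le (min_le_left 1 ((d : ℝ) - s))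
    have hwb := (H2 δ h hδ hh hha2 x hx).2.2 w hw
    have r1 := H1 h hh hha1 G hG g hg0 hg
    have r2 := H1 h hh hha1 1 zero_le_one (fun z => ‖z‖) norm_zero
      (fun y _ z _ => by rw [one_mul]; exact abs_norm_sub_norm_le y z)
    rw [← finsum_nbrs_translate hx, finsum_mem_eq_finite_toFinset_sum _ hfin] at r1 r2
    set S1 := ∑ y ∈ hfin.toFinset, g (y - x) * ‖y - x‖ ^ (-s) with hS1
    set S2 := ∑ y ∈ hfin.toFinset, ‖y - x‖ * ‖y - x‖ ^ (-s) with hS2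
    have hsplit : ∑ y ∈ hfin.toFinset, g (y - x) * (kernel d s D₀ δ ‖y - x‖ * w y) =
        B * (h ^ d * S1) +
        ∑ y ∈ hfin.toFinset, g (y - x) * (kernel d s D₀ δ ‖y - x‖ * (w y - h ^ d)) := by
      rw [hS1, Finset.mul_sum, Finset.mul_sum, ← Finset.sum_add_distrib]
      refine Finset.sum_congr rfl fun y hy => ?_
      rw [hker _ (hmem y hy).1]
      ring
    have hrest : |∑ y ∈ hfin.toFinset, g (y - x) * (kernel d s D₀ δ ‖y - x‖ * (w y - h ^ d))| ≤
        t4 * h ^ α := by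
      calc |∑ y ∈ hfin.toFinset, g (y - x) * (kernel d s D₀ δ ‖y - x‖ * (w y - h ^ d))|
          ≤ ∑ y ∈ hfin.toFinset,
            G * B * (C2 * (h / δ) ^ α) * (h ^ d * (‖y - x‖ * ‖y - x‖ ^ (-s))) := by
            refine (Finset.abs_sum_le_sum_abs _ _).trans (Finset.sum_le_sum fun y hy => ?_)
            obtain ⟨hy1, hy2⟩ := hmem y hy
            rw [abs_mul, abs_mul, abs_of_pos hy2]
            calc |g (y - x)| * (kernel d s D₀ δ ‖y - x‖ * |w y - h ^ d|)
                ≤ (G * ‖y - x‖) * (kernel d s D₀ δ ‖y - x‖ *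
                  (h ^ d * (C2 * (h / δ) ^ α))) := by
                  gcongr
                  · exact hgz _ hy1
                  · exact hwb y (hfin.mem_toFinset.1 hy)
              _ = _ := by rw [hker _ hy1]; ring
        _ = G * B * (C2 * (h / δ) ^ α) * (h ^ d * S2) := by
            rw [hS2, Finset.mul_sum, Finset.mul_sum]
        _ ≤ G * B * (C2 * (h / δ) ^ α) * (J + C1) := by
            gcongr
            have := (abs_le.1 r2).2
            nlinarith
        _ = _ := by
            rw [ht4, Real.div_rpow hh.le hδ.le]
            ring
    rw [hsplit, add_sub_right_comm, ← mul_sub]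
    have h1 : |B * (h ^ d * S1 - ∫ z in ball (0 : Space d) δ, g z * ‖z‖ ^ (-s))| ≤
        B * C1 * G * h ^ α := by
      rw [abs_mul, abs_of_pos hB0]
      calc _ ≤ B * (C1 * G * h) := by gcongr
        _ ≤ B * (C1 * G * h ^ α) := by gcongr
        _ = _ := by ring
    have h2 : 0 ≤ E / η ^ α * h ^ α := by positivity
    refine (abs_add_le _ _).trans ?_
    linarith
  · have hpos := (hc.2 δ h hδ hh hhc x hx).2.2 w hw
    have m0 := hw.1.sum_kernel hfin
    have m2 := hw.1.sum_norm_sq hfin hδ hD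
    have hsum : |∑ y ∈ hfin.toFinset, g (y - x) * (kernel d s D₀ δ ‖y - x‖ * w y)| ≤
        G * (|m| + d) := by
      calc _ ≤ ∑ y ∈ hfin.toFinset, G * (kernel d s D₀ δ ‖y - x‖ * w y +
            ‖y - x‖ ^ 2 * (kernel d s D₀ δ ‖y - x‖ * w y)) := by
            refine (Finset.abs_sum_le_sum_abs _ _).trans (Finset.sum_le_sum fun y hy => ?_)
            obtain ⟨hy1, hy2⟩ := hmem y hy
            have hW := mul_pos hy2 (hpos y (hfin.mem_toFinset.1 hy))
            rw [abs_mul, abs_of_pos hW]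
            calc |g (y - x)| * (kernel d s D₀ δ ‖y - x‖ * w y)
                ≤ (G * ‖y - x‖) * (kernel d s D₀ δ ‖y - x‖ * w y) := by
                  gcongr
                  exact hgz _ hy1
              -- The first absolute moment is not reproduced; `|t| ≤ 1 + |t|²` replaces it by two
              -- that are.
              _ ≤ (G * (1 + ‖y - x‖ ^ 2)) * (kernel d s D₀ δ ‖y - x‖ * w y) := by
                  gcongr
                  nlinarith [sq_nonneg (‖y - x‖ - 1), norm_nonneg (y - x)]
              _ = _ := by ring
        _ = G * (m + d) := by
            rw [← Finset.mul_sum, Finset.sum_add_distrib, m0, m2]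
        _ ≤ _ := by gcongr; exact le_abs_self m
    have hpow : η ^ α ≤ h ^ α := by gcongr
    have h1 : E ≤ E / η ^ α * h ^ α := by
      rw [div_mul_eq_mul_div, le_div_iff₀ (by positivity)]
      gcongr
    have h2 : |B * ∫ z in ball (0 : Space d) δ, g z * ‖z‖ ^ (-s)| ≤ B * (G * J) := by
      rw [abs_mul, abs_of_pos hB0]
      gcongr
    have h3 : 0 ≤ B * C1 * G * h ^ α := by positivity
    have h4 : 0 ≤ t4 * h ^ α := by positivity
    refine (abs_sub _ _).trans ?_
    linarith

theorem nonlocalOp_eq_setIntegral (s D₀ δ : ℝ) (A : Space d → Space d → ℝ) (u : Space d → ℝ)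
    (x : Space d) : nonlocalOp s D₀ δ A u x =
      2 * ∫ y in ball x δ, A x y * (u y - u x) * kernel d s D₀ δ ‖y - x‖ := by
  rw [nonlocalOp, ← integral_indicator measurableSet_ball]
  congr 2
  ext y
  by_cases hy : y ∈ ball x δ
  · rw [Set.indicator_of_mem hy]; ring
  · rw [Set.indicator_of_notMem hy, kernel, if_neg (by simpa [dist_eq_norm] using hy)]
    ring

theorem consistency {s D₀ c δ δmax R M K : ℝ} (hs0 : 0 ≤ s) (hsd : s < d)
    (hD : KernelNormalized d s D₀) (hc : IsPosConst d s D₀ c) (hδ : 0 < δ) (hδm : δ ≤ δmax)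
    {Ω : Set (Space d)} (hΩ : IsOpen Ω) {A : Space d → Space d → ℝ}
    (hAR : ∀ x ∈ region Ω δmax, ∀ y ∈ region Ω δmax, |A x y| ≤ R)
    (hAM : ∀ x ∈ region Ω δmax, C1BoundedBy M (A x) (region Ω δmax))
    {u : Space d → ℝ} (hu : C1BoundedBy K u (region Ω δ)) :
    ∃ C : ℝ, 0 < C ∧ ∀ h : ℝ, 0 < h → h < c * δ → ∀ ω : Space d → Space d → ℝ,
      (∀ x ∈ grid Ω δ h ∩ Ω, IsOptimalWeights s D₀ δ (grid Ω δ h) x (ω x)) →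
      ∀ x ∈ grid Ω δ h ∩ Ω, |discreteOp s D₀ δ h Ω A ω u x - nonlocalOp s D₀ δ A u x| ≤
        C * h ^ min 1 ((d : ℝ) - s) := by
  -- A Lipschitz constant on the `δ`-ball for `z ↦ A(x, x+z)(u(x+z) - u(x))`, by the product rule,
  -- uniform in `x ∈ Ω`.
  set G : ℝ := |R| * |K| + |M| * (|K| * δ) with hGdef
  obtain ⟨C, hC0, hC⟩ := quadrature_error_le hs0 hsd hD hc hδ (G := G) (by positivity)
  refine ⟨2 * C, by positivity, fun h hh hhc ω hω x hx => ?_⟩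
  obtain ⟨hxg, hxΩ⟩ := hx
  have hball := ball_subset_region hxΩ δ
  have hball' := hball.trans (region_mono Ω hδm)
  have hxr : x ∈ region Ω δmax := Or.inl hxΩ
  have hmem : ∀ {z : Space d}, z ∈ ball (0 : Space d) δ → x + z ∈ ball x δ := by
    intro z hz; simpa [dist_eq_norm] using hz
  have hub : ∀ y ∈ ball (0 : Space d) δ, ∀ z ∈ ball (0 : Space d) δ,
      |u (x + y) - u (x + z)| ≤ |K| * ‖y - z‖ := by
    intro y hy z hz
    have := hu.lipschitz (isOpen_region hΩ δ) hball (hmem hy) (hmem hz)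
    rw [add_sub_add_left_eq_sub] at this
    exact this.trans (by gcongr; exact le_abs_self K)
  have hAb : ∀ y ∈ ball (0 : Space d) δ, ∀ z ∈ ball (0 : Space d) δ,
      |A x (x + y) - A x (x + z)| ≤ |M| * ‖y - z‖ := by
    intro y hy z hz
    have := (hAM x hxr).lipschitz (isOpen_region hΩ δmax) hball' (hmem hy) (hmem hz)
    rw [add_sub_add_left_eq_sub] at this
    exact this.trans (by gcongr; exact le_abs_self M)
  have h1 := hC h hh hhc x hxg.1 (ω x) ((isOptimalWeights_grid hxΩ).1 (hω x ⟨hxg, hxΩ⟩))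
    (fun z => A x (x + z) * (u (x + z) - u x)) (by simp) ?_
  · simp only [add_sub_cancel] at h1
    rw [nonlocalOp_eq_setIntegral, discreteOp, nbrs_grid hxΩ]
    have e : ∀ y, A x y * kernel d s D₀ δ ‖y - x‖ * (u y - u x) * ω x y =
        A x y * (u y - u x) * (kernel d s D₀ δ ‖y - x‖ * ω x y) := fun y => by ring
    simp only [e]
    rw [← mul_sub, abs_mul, abs_two, mul_assoc]
    gcongr
  · intro y hy z hz
    have h0 : (0 : Space d) ∈ ball (0 : Space d) δ := by simpa using hδ
    have hz0 := hub z hz 0 h0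
    rw [add_zero, sub_zero] at hz0
    have hzδ : ‖z‖ ≤ δ := by
      have : ‖z‖ < δ := by simpa using hz
      exact this.le
    have e : A x (x + y) * (u (x + y) - u x) - A x (x + z) * (u (x + z) - u x) =
        A x (x + y) * (u (x + y) - u (x + z)) +
        (A x (x + y) - A x (x + z)) * (u (x + z) - u x) := by ring
    rw [e]
    refine (abs_add_le _ _).trans ?_
    rw [abs_mul, abs_mul]
    calc _ ≤ |R| * (|K| * ‖y - z‖) + (|M| * ‖y - z‖) * (|K| * δ) := by
          refine add_le_add (mul_le_mul ?_ (hub y hy z hz) (abs_nonneg _) (abs_nonneg _))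
            (mul_le_mul (hAb y hy z hz) (hz0.trans (by gcongr)) (abs_nonneg _) (by positivity))
          exact (hAR x hxr _ (hball' (hmem hy))).trans (le_abs_self R)
      _ = _ := by rw [hGdef]; ring

/-! ### Stability of the discrete problem -/

/-- The barrier `exp(λ x_i)` in one fixed coordinate suffices, with `λ` depending only on `A`, the
kernel and the dimension. The resulting constant is independent of `h` and of `δ < δ₀`. -/
theorem stability {s D₀ c δmax r M : ℝ} (hs0 : 0 ≤ s) (hsd : s < d)
    (hD : KernelNormalized d s D₀) (hc : IsPosConst d s D₀ c) (hδm : 0 < δmax) (hr : 0 < r)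
    {Ω : Set (Space d)} (hΩ : IsOpen Ω) (hΩb : Bornology.IsBounded Ω)
    {A : Space d → Space d → ℝ}
    (hAr : ∀ x ∈ region Ω δmax, ∀ y ∈ region Ω δmax, r ≤ A x y)
    (hAM : ∀ x ∈ region Ω δmax, C1BoundedBy M (A x) (region Ω δmax)) :
    ∃ δ₀ : ℝ, 0 < δ₀ ∧ δ₀ ≤ δmax ∧ ∃ C : ℝ, 0 < C ∧ ∀ δ h : ℝ, 0 < δ → δ < δ₀ → 0 < h →
      h < c * δ → ∀ ω : Space d → Space d → ℝ,
      (∀ x ∈ grid Ω δ h ∩ Ω, IsOptimalWeights s D₀ δ (grid Ω δ h) x (ω x)) →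
      ∀ (v : Space d → ℝ) (ε : ℝ), 0 < ε →
      (∀ x ∈ grid Ω δ h ∩ Ω, |discreteOp s D₀ δ h Ω A ω v x| ≤ ε) →
      (∀ x ∈ grid Ω δ h, x ∉ Ω → v x = 0) → ∀ x ∈ grid Ω δ h, |v x| ≤ ε * C := by
  have hd : 0 < d := by exact_mod_cast hs0.trans_lt hsd
  have hD0 : 0 < D₀ := hD.pos hs0 hsd
  let i : Fin d := ⟨0, hd⟩
  set κ := D₀ * ballMoment s (MvPolynomial.X i * MvPolynomial.X i) with hκ
  have hκ0 : 0 < κ := mul_pos hD0 (integral_sq_pos hs0 hsd (MvPolynomial.X_ne_zero i))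
  -- Chosen so that the bracket `λ²rκ/4 - λ|M|d` in the barrier estimate equals `λ`.
  set lam := 4 * (|M| * d + 1) / (r * κ) with hlam
  have hlam0 : 0 < lam := by positivity
  obtain ⟨ρ, hρ⟩ := (isBounded_region hΩb δmax).subset_ball (0 : Space d)
  have hδ₀ : 0 < min δmax (1 / lam) := by positivity
  -- The constant is the upper bound of the barrier over a lower bound of its operator. The operator
  -- is at least twice `exp(λ x_i) λ`, and the spare factor gives strictness.
  refine ⟨min δmax (1 / lam), hδ₀, min_le_left _ _,
    Real.exp (lam * ρ) / (Real.exp (-(lam * ρ)) * lam), by positivity,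
    fun δ h hδ hδδ hh hhc ω hω v ε hε hv hv0 => ?_⟩
  have hδ1 : δ ≤ δmax := hδδ.le.trans (min_le_left _ _)
  have hδ2 : lam * δ ≤ 1 := by
    have := hδδ.le.trans (min_le_right _ _)
    rwa [le_div_iff₀ hlam0, mul_comm] at this
  have hcoord : ∀ x ∈ grid Ω δ h, |x i| ≤ ρ := by
    intro x hx
    have : ‖x‖ < ρ := by simpa using hρ (region_mono Ω hδ1 hx.2)
    exact (abs_apply_le_norm x i).trans this.le
  have hpos : ∀ x ∈ grid Ω δ h ∩ Ω, ∀ y ∈ nbrs (grid Ω δ h) δ x, 0 < ω x y := by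
    intro x hx y hy
    rw [nbrs_grid hx.2] at hy
    exact (hc.2 δ h hδ hh hhc x hx.1.1).2.2 _ ((isOptimalWeights_grid hx.2).1 (hω x hx)) y hy
  have hball : ∀ x ∈ Ω, ball x δ ⊆ region Ω δmax := fun x hx =>
    (ball_subset_region hx δ).trans (region_mono Ω hδ1)
  refine abs_le_of_barrier hΩb hh (φ := fun y => Real.exp (lam * y i)) ?_ (by positivity) ?_ ?_
    hε hv hv0
  · intro x hx y hy
    have h1 := hAr x (Or.inl hx.2) y (hball x hx.2 hy.1.2)
    exact mul_nonneg (hr.le.trans h1)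
      (mul_pos (kernel_pos_of_mem_nbrs hD0 hy) (hpos x hx y hy)).le
  · intro x hx
    refine lt_of_lt_of_le ?_ (discreteOp_exp_ge hδ hh hD hD0 (hω x hx).1 (hpos x hx) hr.le
      (fun y hy => hAr x (Or.inl hx.2) y (hball x hx.2 hy)) (M := |M|) (fun y hy => ?_) hlam0 hδ2 i)
    · have h1 : lam ^ 2 / 4 * (r * κ) - lam * (|M| * d) = lam := by
        have : lam * (r * κ) = 4 * (|M| * d + 1) := by rw [hlam]; field_simp
        calc lam ^ 2 / 4 * (r * κ) - lam * (|M| * d)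
            = lam / 4 * (lam * (r * κ)) - lam * (|M| * d) := by ring
          _ = lam := by rw [this]; ring
      rw [h1]
      have h2 : Real.exp (-(lam * ρ)) ≤ Real.exp (lam * x i) := by
        apply Real.exp_le_exp.2
        have := (abs_le.1 (hcoord x hx.1)).1
        nlinarith
      have h3 : Real.exp (-(lam * ρ)) * lam ≤ Real.exp (lam * x i) * lam := by gcongr
      have h4 : 0 < Real.exp (lam * x i) * lam := by positivity
      linarith
    · have := (hAM x (Or.inl hx.2)).lipschitz (isOpen_region hΩ δmax) (hball x hx.2) hy
        (mem_ball_self hδ)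
      exact this.trans (by gcongr; exact le_abs_self M)
  · intro x hx
    refine ⟨(Real.exp_pos _).le, Real.exp_le_exp.2 ?_⟩
    have := (abs_le.1 (hcoord x hx)).2
    gcongr

end MeshfreeNonlocal

end

/-! ### Convergence from consistency and stability -/

open MeshfreeNonlocal
theorem mainTheorem4 (d : ℕ) (s D₀ : ℝ) (hs0 : 0 ≤ s) (hsd : s < (d : ℝ))
    (hD₀ : KernelNormalized d s D₀) :
    (∃ Cpos : ℝ, IsPosConst d s D₀ Cpos) ∧
    ∀ Cpos : ℝ, IsPosConst d s D₀ Cpos →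
    ∀ Ω : Set (Space d), IsOpen Ω → Bornology.IsBounded Ω →
    ∀ (δmax r R M : ℝ) (A : Space d → Space d → ℝ), 0 < δmax → 0 < r →
      (∀ x ∈ region Ω δmax, ∀ y ∈ region Ω δmax, A x y = A y x) →
      (∀ x ∈ region Ω δmax, ∀ y ∈ region Ω δmax, r ≤ A x y ∧ A x y ≤ R) →
      (∀ x ∈ region Ω δmax, C1BoundedBy M (A x) (region Ω δmax)) →
    ∃ δ₀ : ℝ, 0 < δ₀ ∧ ∀ δ : ℝ, 0 < δ → δ < δ₀ →
    ∀ f uD u : Space d → ℝ,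
      IsNonlocalSolution s D₀ δ Ω A f uD u →
      (∃ K : ℝ, C1BoundedBy K u (region Ω δ)) →
    ∃ C : ℝ, ∀ h : ℝ, 0 < h → h < Cpos * δ →
    ∀ ω : Space d → Space d → ℝ,
      (∀ x ∈ grid Ω δ h ∩ Ω, IsOptimalWeights s D₀ δ (grid Ω δ h) x (ω x)) →
    ∃ uh : Space d → ℝ,
      IsDiscreteSolution s D₀ δ h Ω A ω f uD uh ∧
      (∀ vh : Space d → ℝ, IsDiscreteSolution s D₀ δ h Ω A ω f uD vh →
        Set.EqOn vh uh (grid Ω δ h)) ∧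
      ∀ x ∈ grid Ω δ h, |uh x - u x| ≤ C * h ^ min 1 ((d : ℝ) - s) := by
  refine ⟨exists_isPosConst hs0 hsd (hD₀.pos hs0 hsd), ?_⟩
  intro c hc Ω hΩ hΩb δmax r R M A hδm hr _ hA hAM
  obtain ⟨δ₀, hδ₀, hδ₀m, C₁, hC₁, hstab⟩ := stability hs0 hsd hD₀ hc hδm hr hΩ hΩb
    (fun x hx y hy => (hA x hx y hy).1) hAM
  refine ⟨δ₀, hδ₀, fun δ hδ hδδ f uD u hu ⟨K, hK⟩ => ?_⟩
  obtain ⟨C₂, hC₂, hcons⟩ := consistency hs0 hsd hD₀ hc hδ (hδδ.le.trans hδ₀m) hΩ (R := R)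
    (fun x hx y hy => abs_le.2 ⟨by linarith [(hA x hx y hy).1, (hA x hx y hy).2],
      (hA x hx y hy).2⟩) hAM hK
  refine ⟨C₂ * C₁, fun h hh hhc ω hω => ?_⟩
  have hinj : ∀ v : Space d → ℝ, (∀ x ∈ grid Ω δ h ∩ Ω, discreteOp s D₀ δ h Ω A ω v x = 0) →
      (∀ x ∈ grid Ω δ h, x ∉ Ω → v x = 0) → ∀ x ∈ grid Ω δ h, v x = 0 := by
    intro v hv hv0 x hx
    rw [← abs_nonpos_iff]
    -- Stability is stated for residual bounds `ε > 0`, so a zero residual is reached by letting `ε`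
    -- tend to zero.
    refine le_of_forall_pos_le_add fun ε hε => ?_
    have h1 := hstab δ h hδ hδδ hh hhc ω hω v (ε / C₁) (by positivity)
      (fun y hy => by rw [hv y hy, abs_zero]; positivity) hv0 x hx
    rwa [div_mul_cancel₀ _ hC₁.ne', ← zero_add ε] at h1
  have hcollar : ∀ x ∈ grid Ω δ h, x ∉ Ω → x ∈ collar Ω δ := fun x hx hxΩ =>
    hx.2.resolve_left hxΩ
  -- Solving for the error `v = u_h - u` makes the boundary condition homogeneous and turns the
  -- right-hand side into the consistency error.
  obtain ⟨v, hv, hv0⟩ := exists_discrete_correction hΩb hh hinj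
    fun x => -f x - discreteOp s D₀ δ h Ω A ω u x
  have hop : ∀ (w w' : Space d → ℝ) (a : ℝ) (x : Space d),
      discreteOp s D₀ δ h Ω A ω (fun y => w y + a * w' y) x =
      discreteOp s D₀ δ h Ω A ω w x + a * discreteOp s D₀ δ h Ω A ω w' x :=
    fun w w' a x => discreteOp_add_smul hh w w' a x
  refine ⟨fun y => u y + 1 * v y, ⟨fun x hx => ?_, fun x hx => ?_⟩, fun vh hvh => ?_,
    fun x hx => ?_⟩
  · rw [hop, hv x hx]; ring
  · simp only [hv0 x hx.2.2, mul_zero, add_zero, hu.2 x hx.2]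
  · have h1 := hinj (fun y => vh y + -1 * (u y + 1 * v y)) (fun x hx => ?_) (fun x hx hxΩ => ?_)
    · intro x hx
      have := h1 x hx
      linarith
    · have h2 := hvh.1 x hx
      rw [hop, hop, hv x hx]
      linarith
    · rw [hvh.2 x ⟨hx, hcollar x hx hxΩ⟩, hv0 x hxΩ, hu.2 x (hcollar x hx hxΩ)]
      ring
  · have h1 := hstab δ h hδ hδδ hh hhc ω hω v (C₂ * h ^ min 1 ((d : ℝ) - s)) (by positivity)
      (fun y hy => ?_) (fun y _ hyΩ => hv0 y hyΩ) x hx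
    · simp only [one_mul, add_sub_cancel_left]
      calc |v x| ≤ C₂ * h ^ min 1 ((d : ℝ) - s) * C₁ := h1
        _ = _ := by ring
    · have h2 := hcons h hh hhc ω hω y hy
      have h3 := hu.1 y hy.2
      rw [hv y hy, ← abs_neg]
      have e : -(-f y - discreteOp s D₀ δ h Ω A ω u y) =
          discreteOp s D₀ δ h Ω A ω u y - nonlocalOp s D₀ δ A u y := by
        rw [← h3]; ring
      rwa [e]
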